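/- Let $l,m\ge 0$ and $0\le k\le l+m$ be integers, and let $a,b\ge 0$ be integers with $a+b=k+1$. Let $V=\mathbb C^{l+1}$ with the indefinite Hermitian form $(x,x')=x_0\bar x'_0-\sum_{i\ge1}x_i\bar x'_i$ and $W=\mathbb C^{m+1}$ with the standard Hermitian form $(y,y')=\sum_j y_j\bar y'_j$. Let $\mathbf H^l=\{(1:x_1:\dots:x_l)\in\mathbf P(V): \sum|x_i|^2<1\}$ be complex hyperbolic space, $\mathbf P^m=\mathbf P(W)$, and let $M=\mathbf H^l\times\mathbf P^m$ carry the Kähler metric with Kähler form $$-\sqrt{-1}\,\partial\bar\partial\log\Big(1-\sum_i|x_i|^2\Big)+\sqrt{-1}\,\partial\bar\partial\log\Big(1+\sum_j|y_j|^2\Big)$$ in affine coordinates $(x,y)$ (with $y$ in any of the standard affine charts of $\mathbf P^m$). The $k$-th twistor space $Z_k(M)$ is the total space of the Grassmannian bundle $G_k(T^{(1,0)}M)$, whose points are triples $(p,q,K)$ with $(p,q)\in M$ and $K\subset T^{(1,0)}_{(p,q)}M$ a complex subspace of dimension $k$, with the following almost complex structure. The Hermitian connection of $M$ splits $TZ_k(M)=T_V\oplus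 T_H$; on $T_V$ (the tangent spaces of the Grassmannian fibres) one takes the natural complex structure, and on $T_H\cong T^{(1,0)}_{(p,q)}M=K\oplus K^\perp$ one takes the given complex structure on $K^\perp$ and its conjugate on $K$. Let $L_{\mathbf H^l}$, $L_{\mathbf P^m}$ be the tautological line bundles, with fibres $p\subset V$ and $q\subset W$, let $p_1,p_2$ be the projections of $M$ to its factors, and let $L_{Z_k(M)}$ be the tautological line bundle of the Grassmannian bundle, with fibre $\Lambda^kK$. The total space of $L_{Z_k(M)}\otimes p_1^*L_{\mathbf H^l}^{\otimes a}\otimes p_2^*L_{\mathbf P^m}^{\otimes b}$ has the almost complex structure induced by that of $Z_k(M)$ and by the canonical connection of this line bundle (the one induced from the Hermitian connection of $M$ by orthogonal projection to the tautological subbundle, and from the forms on $V$ and $W$). For $x\in p$, $y\in q$ the isomorphisms $T^{(1,0)}_p\mathbf H^l=\mathrm{Hom}(p,V/p)\cong\mathrm{Hom}(p,p^\perp)$ and $T^{(1,0)}_q\mathbf P^m\cong\mathrm{Hom}(q,q^\perp)$ allow one to evaluate tangent vectors at $(x,y)$, and so to regard $z\in\Lambda^kK$ as an element $\hat z$ of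 $\Lambda^k(p^\perp\oplus q^\perp)\subset\Lambda^k(V\oplus W)$. Let $$\phi_{a,b}:\ L_{Z_k(M)}\otimes p_1^*L_{\mathbf H^l}^{\otimes a}\otimes p_2^*L_{\mathbf P^m}^{\otimes b}\longrightarrow \Lambda^aV\otimes\Lambda^bW$$ be the map, linear on the fibres, that sends $z\otimes x^{\otimes a}\otimes y^{\otimes b}$ (for nonzero $x\in p$, $y\in q$) to the component in $\Lambda^aV\otimes\Lambda^bW$ of $$x\wedge\Big(1-\frac{y\wedge i(\bar y)}{(y,y)}\Big)\hat z+y\wedge\Big(1-\frac{x\wedge i(\bar x)}{(x,x)}\Big)\hat z\ \in\ \Lambda^{k+1}(V\oplus W)=\bigoplus_{a'+b'=k+1}\Lambda^{a'}V\otimes\Lambda^{b'}W ,$$ where $i$ denotes interior multiplication and $\bar y=(\,\cdot\,,y)$, $\bar x=(\,\cdot\,,x)$. Then $\phi_{a,b}$ is holomorphic, i.e. it is smooth and its differential is complex linear: $d\phi_{a,b}\circ J=\sqrt{-1}\,d\phi_{a,b}$ for the almost complex structure $J$ of the total space. -/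

import Mathlib

noncomputable section

open scoped TensorProduct LinearAlgebra.Projectivization ContDiff ComplexConjugate Matrix
open Complex

namespace BochnerTwistor

/-! ### The vector spaces `V`, `W` with their metrics, and the model space -/

/-- `ℂ^(n+1)` with its coordinates numbered `0, …, n`. -/
abbrev CVec (n : ℕ) : Type := Fin (n + 1) → ℂ

/-- The signs `(1, -1, …, -1)` of the indefinite metric on `V = ℂ^(l+1)`. -/
def signV (l : ℕ) : Fin (l + 1) → ℂ := fun i => if i = 0 then 1 else -1

/-- The signs `(1, …, 1)` of the Hermitian metric on `W = ℂ^(m+1)`. -/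
def signW (m : ℕ) : Fin (m + 1) → ℂ := fun _ => 1

/-- For the Hermitian form `(u, v) = ∑ i, ε i * u i * conj (v i)`, the covector
`v̄ = (·, v)` attached to the vector `v`. -/
def bar {n : ℕ} (ε : Fin (n + 1) → ℂ) (v : CVec n) : Module.Dual ℂ (CVec n) :=
  ∑ i, (ε i * conj (v i)) • (LinearMap.proj i : CVec n →ₗ[ℂ] ℂ)

theorem bar_apply {n : ℕ} (ε : Fin (n + 1) → ℂ) (v u : CVec n) :
    bar ε v u = ∑ i, ε i * conj (v i) * u i := by
  simp [bar]

/-- The vector of homogeneous coordinates `(y_0 : … : 1 : … : y_n)`, with `1` at the place `j`. -/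
def affine {n : ℕ} (j : Fin (n + 1)) (y : Fin n → ℂ) : CVec n :=
  Fin.insertNth (α := fun _ => ℂ) j 1 y

/-- The constant vector field obtained by differentiating `affine j` in the direction `v`. -/
def daffine {n : ℕ} (j : Fin (n + 1)) (v : Fin n → ℂ) : CVec n :=
  Fin.insertNth (α := fun _ => ℂ) j 0 v

theorem affine_ne_zero {n : ℕ} (j : Fin (n + 1)) (y : Fin n → ℂ) : affine j y ≠ 0 := by
  intro h
  have := congrFun h j
  simp [affine] at this

/-- The point of projective space with affine coordinates `y` in the chart `j`. -/
def affinePoint {n : ℕ} (j : Fin (n + 1)) (y : Fin n → ℂ) : ℙ ℂ (CVec n) :=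
  Projectivization.mk ℂ (affine j y) (affine_ne_zero j y)

/-- Complex hyperbolic space `H^l` inside `P(V)`:
the points `(1 : x_1 : … : x_l)` with `|x_1|² + … + |x_l|² < 1`. -/
def hyperbolic (l : ℕ) : Set (ℙ ℂ (CVec l)) :=
  {p | ∃ x : Fin l → ℂ, ∑ i, ‖x i‖ ^ 2 < 1 ∧ p = affinePoint 0 x}

/-- The holomorphic tangent space `T^{(1,0)}_p P^n = Hom(p, ℂ^(n+1)/p)`. -/
abbrev TangentP {n : ℕ} (p : ℙ ℂ (CVec n)) : Type :=
  p.submodule →ₗ[ℂ] (CVec n ⧸ p.submodule)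

/-- The holomorphic tangent space `T^{(1,0)}_{(p,q)} M` of `M = H^l × P^m`. -/
def TangentM {l m : ℕ} (p : ℙ ℂ (CVec l)) (q : ℙ ℂ (CVec m)) : Type :=
  TangentP p × TangentP q

instance {l m : ℕ} (p : ℙ ℂ (CVec l)) (q : ℙ ℂ (CVec m)) : AddCommGroup (TangentM p q) :=
  inferInstanceAs (AddCommGroup (TangentP p × TangentP q))

instance {l m : ℕ} (p : ℙ ℂ (CVec l)) (q : ℙ ℂ (CVec m)) : Module ℂ (TangentM p q) :=
  inferInstanceAs (Module ℂ (TangentP p × TangentP q))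

/-! ### The twistor space and the line bundle, as sets -/

/-- The points of the twistor space `Z_k(M)` of `M = H^l × P^m`: a point `(p, q)` of `M` and a
`k`-dimensional complex subspace `K` of `T^{(1,0)}_{(p,q)} M`. -/
structure Twistor (l m k : ℕ) where
  p : ℙ ℂ (CVec l)
  hp : p ∈ hyperbolic l
  q : ℙ ℂ (CVec m)
  K : Submodule ℂ (TangentM p q)
  finrank_K : Module.finrank ℂ K = k

/-- The fibre `Λ^k K ⊗ p^{⊗a} ⊗ q^{⊗b}` of `L_{Z_k(M)} ⊗ p_1^* L^a ⊗ p_2^* L^b`. -/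
abbrev LineFiber {l m k : ℕ} (a b : ℕ) (κ : Twistor l m k) : Type :=
  ((⋀[ℂ]^k κ.K) ⊗[ℂ] (⨂[ℂ]^a κ.p.submodule)) ⊗[ℂ] (⨂[ℂ]^b κ.q.submodule)

/-- The total space of the line bundle `L_{Z_k(M)} ⊗ p_1^* L^a ⊗ p_2^* L^b`. -/
abbrev TotalSpace (l m k a b : ℕ) : Type :=
  Σ κ : Twistor l m k, LineFiber a b κ

/-! ### The map `φ_{a,b}` -/

theorem bar_self_ne_zero_W {m : ℕ} {y : CVec m} (hy : y ≠ 0) : bar (signW m) y y ≠ 0 := by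
  have h : bar (signW m) y y = ((∑ i, ‖y i‖ ^ 2 : ℝ) : ℂ) := by
    rw [bar_apply]
    push_cast
    refine Finset.sum_congr rfl fun i _ => ?_
    simp [signW, Complex.conj_mul']
  rw [h, Complex.ofReal_ne_zero]
  intro h0
  apply hy
  funext i
  have := (Finset.sum_eq_zero_iff_of_nonneg (fun i _ => by positivity)).1 h0 i (Finset.mem_univ i)
  simpa using this

theorem bar_self_affine_V {l : ℕ} (x : Fin l → ℂ) :
    bar (signV l) (affine 0 x) (affine 0 x) = ((1 - ∑ i, ‖x i‖ ^ 2 : ℝ) : ℂ) := by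
  rw [bar_apply, Fin.sum_univ_succ]
  push_cast
  simp [signV, affine, Complex.conj_mul', Fin.succ_ne_zero, sub_eq_add_neg]

theorem bar_smul_self {n : ℕ} (ε : Fin (n + 1) → ℂ) (c : ℂ) (v u : CVec n) :
    bar ε (c • v) u = conj c * bar ε v u := by
  simp only [bar_apply, Finset.mul_sum]
  refine Finset.sum_congr rfl fun i _ => ?_
  simp; ring

theorem mem_submodule_iff {n : ℕ} (p : ℙ ℂ (CVec n)) {x : CVec n} (hx : x ∈ p.submodule)
    (hx0 : x ≠ 0) (v : CVec n) : v ∈ p.submodule ↔ ∃ c : ℂ, v = c • x := by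
  rw [Projectivization.submodule_eq, Submodule.mem_span_singleton] at hx ⊢
  obtain ⟨s, rfl⟩ := hx
  have hs : s ≠ 0 := by rintro rfl; simp at hx0
  constructor
  · rintro ⟨t, rfl⟩
    exact ⟨t / s, by rw [smul_smul, div_mul_cancel₀ _ hs]⟩
  · rintro ⟨c, rfl⟩
    exact ⟨c * s, by rw [smul_smul]⟩

theorem bar_self_ne_zero_V {l : ℕ} {p : ℙ ℂ (CVec l)} (hp : p ∈ hyperbolic l) {x : CVec l}
    (hx : x ∈ p.submodule) (hx0 : x ≠ 0) : bar (signV l) x x ≠ 0 := by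
  obtain ⟨u, hu, rfl⟩ := hp
  obtain ⟨c, rfl⟩ := (mem_submodule_iff _ (x := affine 0 u)
    (Submodule.mem_span_singleton_self _) (affine_ne_zero 0 u) x).1 hx
  have hc : c ≠ 0 := by rintro rfl; simp at hx0
  rw [bar_smul_self, map_smul, bar_self_affine_V, smul_eq_mul]
  refine mul_ne_zero (by simpa using hc) (mul_ne_zero hc ?_)
  rw [Complex.ofReal_ne_zero]
  linarith

/-- The orthogonal projection `v ↦ v - (v, x)/(x, x) x` along the vector `x`. -/
def orthoAlong {n : ℕ} (ε : Fin (n + 1) → ℂ) (x : CVec n) : CVec n →ₗ[ℂ] CVec n :=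
  LinearMap.id - (bar ε x).smulRight ((bar ε x x)⁻¹ • x)

/-- The identification of `ℂ^(n+1)/p` with `p^⊥`, for a non-isotropic line `p`. -/
def orthoLift {n : ℕ} (ε : Fin (n + 1) → ℂ) (p : ℙ ℂ (CVec n)) (hp : bar ε p.rep p.rep ≠ 0) :
    (CVec n ⧸ p.submodule) →ₗ[ℂ] CVec n :=
  p.submodule.liftQ (orthoAlong ε p.rep) (by
    rw [Projectivization.submodule_eq, Submodule.span_singleton_le_iff_mem, LinearMap.mem_ker]
    simp [orthoAlong, smul_smul, hp])

theorem rep_mem {n : ℕ} (p : ℙ ℂ (CVec n)) : p.rep ∈ p.submodule := by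
  rw [Projectivization.submodule_eq]
  exact Submodule.mem_span_singleton_self _

variable {l m k : ℕ}

/-- With representatives `x ∈ p`, `y ∈ q` chosen, the identification of a tangent vector
`(α, β) ∈ Hom(p, V/p) ⊕ Hom(q, W/q)` with the element `(α(x), β(y))` of `p^⊥ ⊕ q^⊥ ⊆ V ⊕ W`. -/
def tangentToVec (κ : Twistor l m k) (x : κ.p.submodule) (y : κ.q.submodule) :
    TangentM κ.p κ.q →ₗ[ℂ] (CVec l × CVec m) where
  toFun u :=
    (orthoLift (signV l) κ.p (bar_self_ne_zero_V κ.hp (rep_mem _) κ.p.rep_nonzero) (u.1 x),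
      orthoLift (signW m) κ.q (bar_self_ne_zero_W κ.q.rep_nonzero) (u.2 y))
  map_add' u v := Prod.ext (map_add _ (u.1 x) (v.1 x)) (map_add _ (u.2 y) (v.2 y))
  map_smul' c u := Prod.ext (map_smul _ c (u.1 x)) (map_smul _ c (u.2 y))

/-- `z ∈ Λ^k K` regarded as an element of `Λ(V ⊕ W)`, through representatives `x`, `y`. -/
def extToVec (κ : Twistor l m k) (x : κ.p.submodule) (y : κ.q.submodule) :
    (⋀[ℂ]^k κ.K) →ₗ[ℂ] ExteriorAlgebra ℂ (CVec l × CVec m) :=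
  (ExteriorAlgebra.map (tangentToVec κ x y ∘ₗ κ.K.subtype)).toLinearMap ∘ₗ Submodule.subtype _

/-- The vector `v ∈ V` in `Λ(V ⊕ W)`. -/
def inV (v : CVec l) : ExteriorAlgebra ℂ (CVec l × CVec m) := ExteriorAlgebra.ι ℂ (v, 0)

/-- The vector `w ∈ W` in `Λ(V ⊕ W)`. -/
def inW (w : CVec m) : ExteriorAlgebra ℂ (CVec l × CVec m) := ExteriorAlgebra.ι ℂ (0, w)

/-- Interior multiplication by a covector. -/
def contract {M : Type*} [AddCommGroup M] [Module ℂ M] (d : Module.Dual ℂ M) :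
    ExteriorAlgebra ℂ M →ₗ[ℂ] ExteriorAlgebra ℂ M :=
  CliffordAlgebra.contractLeft (Q := (0 : QuadraticForm ℂ M)) d

/-- `x̄` as a covector of `V ⊕ W`. -/
def barV (x : CVec l) : Module.Dual ℂ (CVec l × CVec m) :=
  bar (signV l) x ∘ₗ LinearMap.fst ℂ (CVec l) (CVec m)

/-- `ȳ` as a covector of `V ⊕ W`. -/
def barW (y : CVec m) : Module.Dual ℂ (CVec l × CVec m) :=
  bar (signW m) y ∘ₗ LinearMap.snd ℂ (CVec l) (CVec m)

/-- `1 - x ∧ i(x̄) / (x, x)` on `Λ(V ⊕ W)`. -/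
def projV (x : CVec l) :
    ExteriorAlgebra ℂ (CVec l × CVec m) →ₗ[ℂ] ExteriorAlgebra ℂ (CVec l × CVec m) :=
  LinearMap.id - (bar (signV l) x x)⁻¹ • (LinearMap.mulLeft ℂ (inV x) ∘ₗ contract (barV x))

/-- `1 - y ∧ i(ȳ) / (y, y)` on `Λ(V ⊕ W)`. -/
def projW (y : CVec m) :
    ExteriorAlgebra ℂ (CVec l × CVec m) →ₗ[ℂ] ExteriorAlgebra ℂ (CVec l × CVec m) :=
  LinearMap.id - (bar (signW m) y y)⁻¹ • (LinearMap.mulLeft ℂ (inW y) ∘ₗ contract (barW y))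

/-- `z ↦ x ∧ (1 - y ∧ i(ȳ)/(y,y)) z + y ∧ (1 - x ∧ i(x̄)/(x,x)) z` on `Λ(V ⊕ W)`. -/
def wedgeFormula (x : CVec l) (y : CVec m) :
    ExteriorAlgebra ℂ (CVec l × CVec m) →ₗ[ℂ] ExteriorAlgebra ℂ (CVec l × CVec m) :=
  LinearMap.mulLeft ℂ (inV x) ∘ₗ projW y + LinearMap.mulLeft ℂ (inW y) ∘ₗ projV x

/-- `Λ V ⊗ Λ W` with the product `(u ⊗ v)(u' ⊗ v') = (-1)^{|v||u'|} (u u') ⊗ (v v')`. -/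
abbrev ExtTensor (l m : ℕ) : Type :=
  GradedTensorProduct ℂ (fun i : ℕ => ⋀[ℂ]^i (CVec l)) (fun i : ℕ => ⋀[ℂ]^i (CVec m))

/-- The linear map `(v, w) ↦ v ⊗ 1 + 1 ⊗ w`. -/
def splitι (l m : ℕ) : (CVec l × CVec m) →ₗ[ℂ] ExtTensor l m :=
  LinearMap.coprod
    ((GradedTensorProduct.includeLeft (fun i : ℕ => ⋀[ℂ]^i (CVec l))
      (fun i : ℕ => ⋀[ℂ]^i (CVec m))).toLinearMap ∘ₗ ExteriorAlgebra.ι ℂ)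
    ((GradedTensorProduct.includeRight (fun i : ℕ => ⋀[ℂ]^i (CVec l))
      (fun i : ℕ => ⋀[ℂ]^i (CVec m))).toLinearMap ∘ₗ ExteriorAlgebra.ι ℂ)

theorem ι_mem (n : ℕ) (v : CVec n) : ExteriorAlgebra.ι ℂ v ∈ ⋀[ℂ]^1 (CVec n) := by
  simpa only [ExteriorAlgebra.exteriorPower, pow_one] using LinearMap.mem_range_self _ v

theorem splitι_sq (l m : ℕ) (u : CVec l × CVec m) : splitι l m u * splitι l m u = 0 := by
  obtain ⟨v, w⟩ := u
  have e1 := GradedTensorProduct.tmul_coe_mul_coe_tmul (R := ℂ) (fun i : ℕ => ⋀[ℂ]^i (CVec l))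
    (fun i : ℕ => ⋀[ℂ]^i (CVec m)) 1 ⟨_, ι_mem m w⟩ ⟨_, ι_mem l v⟩ 1
  have e2 := GradedTensorProduct.tmul_one_mul_one_tmul (R := ℂ) (fun i : ℕ => ⋀[ℂ]^i (CVec l))
    (fun i : ℕ => ⋀[ℂ]^i (CVec m)) (ExteriorAlgebra.ι ℂ v) (ExteriorAlgebra.ι ℂ w)
  simp only [splitι, LinearMap.coprod_apply, LinearMap.comp_apply, AlgHom.toLinearMap_apply,
    add_mul, mul_add, ← map_mul, ExteriorAlgebra.ι_sq_zero, map_zero, zero_add, add_zero]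
  simp only [GradedTensorProduct.includeLeft_apply, GradedTensorProduct.includeRight_apply] at *
  rw [e2, e1]
  simp

/-- The algebra isomorphism `Λ(V ⊕ W) → Λ V ⊗ Λ W`, `(v, w) ↦ v ⊗ 1 + 1 ⊗ w`. -/
def split (l m : ℕ) : ExteriorAlgebra ℂ (CVec l × CVec m) →ₐ[ℂ] ExtTensor l m :=
  ExteriorAlgebra.lift ℂ ⟨splitι l m, splitι_sq l m⟩

/-- The projection of `Λ V` to its homogeneous part `Λ^a V`. -/
def homPart (n a : ℕ) : ExteriorAlgebra ℂ (CVec n) →ₗ[ℂ] ⋀[ℂ]^a (CVec n) :=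
  DirectSum.component ℂ ℕ (fun i : ℕ => ⋀[ℂ]^i (CVec n)) a ∘ₗ
    (DirectSum.decomposeLinearEquiv (fun i : ℕ => ⋀[ℂ]^i (CVec n))).toLinearMap

/-- The projection of `Λ(V ⊕ W) = ⨁ Λ^a V ⊗ Λ^b W` to its summand `Λ^a V ⊗ Λ^b W`. -/
def bidegreePart (l m a b : ℕ) :
    ExteriorAlgebra ℂ (CVec l × CVec m) →ₗ[ℂ] (⋀[ℂ]^a (CVec l)) ⊗[ℂ] (⋀[ℂ]^b (CVec m)) :=
  TensorProduct.map (homPart l a) (homPart m b) ∘ₗ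
    ((GradedTensorProduct.of ℂ (fun i : ℕ => ⋀[ℂ]^i (CVec l))
      (fun i : ℕ => ⋀[ℂ]^i (CVec m))).symm : ExtTensor l m →ₗ[ℂ]
        ExteriorAlgebra ℂ (CVec l) ⊗[ℂ] ExteriorAlgebra ℂ (CVec m)) ∘ₗ
    (split l m).toLinearMap

/-- The linear form on `p^{⊗a}` that takes the value `1` on the `a`-th power of the chosen
representative of `p`. -/
def powerCoord {n : ℕ} (ε : Fin (n + 1) → ℂ) (a : ℕ) (p : ℙ ℂ (CVec n)) :
    (⨂[ℂ]^a p.submodule) →ₗ[ℂ] ℂ :=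
  PiTensorProduct.lift ((MultilinearMap.mkPiAlgebra ℂ (Fin a) ℂ).compLinearMap fun _ =>
    (bar ε p.rep p.rep)⁻¹ • (bar ε p.rep ∘ₗ p.submodule.subtype))

/-- The linear map `u ⊗ v ⊗ w ↦ g(v) h(w) f(u)`. -/
def applyForms {A B C N : Type*} [AddCommMonoid A] [Module ℂ A] [AddCommMonoid B] [Module ℂ B]
    [AddCommMonoid C] [Module ℂ C] [AddCommMonoid N] [Module ℂ N]
    (f : A →ₗ[ℂ] N) (g : B →ₗ[ℂ] ℂ) (h : C →ₗ[ℂ] ℂ) : (A ⊗[ℂ] B) ⊗[ℂ] C →ₗ[ℂ] N :=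
  f ∘ₗ (TensorProduct.rid ℂ A).toLinearMap ∘ₗ
    TensorProduct.map ((TensorProduct.rid ℂ A).toLinearMap ∘ₗ
      TensorProduct.map LinearMap.id g) h

theorem applyForms_tmul {A B C N : Type*} [AddCommMonoid A] [Module ℂ A] [AddCommMonoid B]
    [Module ℂ B] [AddCommMonoid C] [Module ℂ C] [AddCommMonoid N] [Module ℂ N]
    (f : A →ₗ[ℂ] N) (g : B →ₗ[ℂ] ℂ) (h : C →ₗ[ℂ] ℂ) (u : A) (v : B) (w : C) :
    applyForms f g h ((u ⊗ₜ[ℂ] v) ⊗ₜ[ℂ] w) = (g v * h w) • f u := by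
  simp [applyForms, smul_smul, mul_comm]

/-- The restriction of `φ_{a,b}` to the fibre over `κ`: the linear map
`Λ^k K ⊗ p^{⊗a} ⊗ q^{⊗b} → Λ^a V ⊗ Λ^b W` with
`z ⊗ x^{⊗a} ⊗ y^{⊗b} ↦ (x ∧ (1 - y ∧ i(ȳ)/(y,y)) z + y ∧ (1 - x ∧ i(x̄)/(x,x)) z)_{a,b}`.
It is written down with chosen representatives `x`, `y` of the lines `p`, `q`;
`plucker_tmul` shows that the formula then holds for all representatives. -/
def pluckerFiber (a b : ℕ) (κ : Twistor l m k) :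
    LineFiber a b κ →ₗ[ℂ] (⋀[ℂ]^a (CVec l)) ⊗[ℂ] (⋀[ℂ]^b (CVec m)) :=
  applyForms
    (bidegreePart l m a b ∘ₗ wedgeFormula κ.p.rep κ.q.rep ∘ₗ
      extToVec κ ⟨κ.p.rep, rep_mem _⟩ ⟨κ.q.rep, rep_mem _⟩)
    (powerCoord (signV l) a κ.p) (powerCoord (signW m) b κ.q)

/-- The map `φ_{a,b}` on the total space of the line bundle. -/
def plucker (l m k a b : ℕ) (e : TotalSpace l m k a b) :
    (⋀[ℂ]^a (CVec l)) ⊗[ℂ] (⋀[ℂ]^b (CVec m)) :=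
  pluckerFiber a b e.1 e.2

/-! Independence of the chosen representatives. -/

theorem contract_map {M N : Type*} [AddCommGroup M] [Module ℂ M] [AddCommGroup N] [Module ℂ N]
    (f : M →ₗ[ℂ] N) (d : Module.Dual ℂ N) (hd : d ∘ₗ f = 0) (z : ExteriorAlgebra ℂ M) :
    contract d (ExteriorAlgebra.map f z) = 0 := by
  induction z using CliffordAlgebra.left_induction with
  | algebraMap r =>
    have : ExteriorAlgebra.map f ((algebraMap ℂ (CliffordAlgebra 0)) r) =
      algebraMap ℂ (CliffordAlgebra (0 : QuadraticForm ℂ N)) r := AlgHom.commutes _ r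
    rw [this]
    exact CliffordAlgebra.contractLeft_algebraMap (Q := (0 : QuadraticForm ℂ N)) d r
  | add x y hx hy => rw [map_add, map_add, hx, hy, add_zero]
  | ι_mul x v hx =>
    have h1 : ExteriorAlgebra.map f ((CliffordAlgebra.ι 0) v * x) =
      ExteriorAlgebra.ι ℂ (f v) * ExteriorAlgebra.map f x := by
      rw [map_mul]; congr 1; exact ExteriorAlgebra.map_apply_ι f v
    rw [h1]
    have h2 := CliffordAlgebra.contractLeft_ι_mul (Q := (0 : QuadraticForm ℂ N)) (d := d)
      (f v) (ExteriorAlgebra.map f x)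
    refine h2.trans ?_
    have h3 : d (f v) = 0 := LinearMap.congr_fun hd v
    have h4 : CliffordAlgebra.contractLeft (Q := (0 : QuadraticForm ℂ N)) d
      (ExteriorAlgebra.map f x) = 0 := hx
    rw [h3, h4]; simp

theorem bar_orthoLift {n : ℕ} (ε : Fin (n + 1) → ℂ) (p : ℙ ℂ (CVec n))
    (hp : bar ε p.rep p.rep ≠ 0) {x : CVec n} (hx : x ∈ p.submodule)
    (u : CVec n ⧸ p.submodule) : bar ε x (orthoLift ε p hp u) = 0 := by
  obtain ⟨c, rfl⟩ := (mem_submodule_iff p (rep_mem p) p.rep_nonzero x).1 hx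
  obtain ⟨v, rfl⟩ := Submodule.mkQ_surjective _ u
  rw [bar_smul_self]
  simp [orthoLift, orthoAlong, hp]

theorem wedgeFormula_of_contract_eq_zero (x : CVec l) (y : CVec m)
    (w : ExteriorAlgebra ℂ (CVec l × CVec m)) (h1 : contract (barV x) w = 0)
    (h2 : contract (barW y) w = 0) : wedgeFormula x y w = (inV x + inW y) * w := by
  simp [wedgeFormula, projV, projW, h1, h2, add_mul]

theorem extToVec_apply (κ : Twistor l m k) (x : κ.p.submodule) (y : κ.q.submodule)
    (z : ⋀[ℂ]^k κ.K) : extToVec κ x y z =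
      ExteriorAlgebra.map (tangentToVec κ x y ∘ₗ κ.K.subtype) z.1 := rfl

theorem wedgeFormula_extToVec (κ : Twistor l m k) (x : κ.p.submodule) (y : κ.q.submodule)
    (z : ⋀[ℂ]^k κ.K) :
    wedgeFormula x.1 y.1 (extToVec κ x y z) = (inV x.1 + inW y.1) * extToVec κ x y z := by
  rw [extToVec_apply]
  apply wedgeFormula_of_contract_eq_zero
  · refine contract_map _ _ (LinearMap.ext fun t => ?_) _
    exact bar_orthoLift (signV l) κ.p
      (bar_self_ne_zero_V κ.hp (rep_mem _) κ.p.rep_nonzero) x.2 _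
  · refine contract_map _ _ (LinearMap.ext fun t => ?_) _
    exact bar_orthoLift (signW m) κ.q (bar_self_ne_zero_W κ.q.rep_nonzero) y.2 _

theorem map_smul_id_of_mem {M : Type*} [AddCommGroup M] [Module ℂ M] (s : ℂ) (i : ℕ)
    {A : ExteriorAlgebra ℂ M} (hA : A ∈ ⋀[ℂ]^i M) :
    ExteriorAlgebra.map (s • (LinearMap.id : M →ₗ[ℂ] M)) A = s ^ i • A := by
  rw [← ExteriorAlgebra.ιMulti_span_fixedDegree] at hA
  induction hA using Submodule.span_induction with
  | mem x hx =>
    obtain ⟨v, rfl⟩ := hx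
    rw [ExteriorAlgebra.map_apply_ιMulti]
    have := (ExteriorAlgebra.ιMulti ℂ i (M := M)).map_smul_univ (fun _ => s) v
    simpa [Function.comp_def] using this
  | zero => simp
  | add x y _ _ hx hy => rw [map_add, hx, hy, smul_add]
  | smul c x _ hx => rw [map_smul, hx, smul_comm]

theorem homPart_map (n a : ℕ) (s : ℂ) (A : ExteriorAlgebra ℂ (CVec n)) :
    homPart n a (ExteriorAlgebra.map (s • (LinearMap.id : CVec n →ₗ[ℂ] CVec n)) A) =
      s ^ a • homPart n a A := by
  induction A using DirectSum.Decomposition.inductionOn fun i : ℕ => ⋀[ℂ]^i (CVec n) with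
  | zero => simp
  | add x y hx hy => rw [map_add, map_add, hx, hy, map_add, smul_add]
  | @homogeneous i A =>
    rw [map_smul_id_of_mem s i A.2, map_smul]
    by_cases h : i = a
    · subst h; rfl
    · have : homPart n a (A : ExteriorAlgebra ℂ (CVec n)) = 0 := by
        have h2 : homPart n a (A : ExteriorAlgebra ℂ (CVec n)) =
          (DirectSum.decompose (fun i : ℕ => ⋀[ℂ]^i (CVec n)) (A : ExteriorAlgebra ℂ (CVec n))) a :=
          rfl
        rw [h2, DirectSum.decompose_coe, DirectSum.of_eq_of_ne _ _ _ (Ne.symm h)]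
      rw [this, smul_zero, smul_zero]

/-- The map `(v, w) ↦ (s v, t w)` of `V ⊕ W`. -/
def scale (l m : ℕ) (s t : ℂ) : (CVec l × CVec m) →ₗ[ℂ] (CVec l × CVec m) :=
  LinearMap.prodMap (s • LinearMap.id) (t • LinearMap.id)

theorem map_mem_of_mem {M : Type*} [AddCommGroup M] [Module ℂ M] (s : ℂ) (i : ℕ)
    {A : ExteriorAlgebra ℂ M} (hA : A ∈ ⋀[ℂ]^i M) :
    ExteriorAlgebra.map (s • (LinearMap.id : M →ₗ[ℂ] M)) A ∈ ⋀[ℂ]^i M := by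
  rw [map_smul_id_of_mem s i hA]
  exact Submodule.smul_mem _ _ hA

/-- The algebra endomorphism of `Λ V ⊗ Λ W` induced by `scale`. -/
def scaleTensor (l m : ℕ) (s t : ℂ) : ExtTensor l m →ₐ[ℂ] ExtTensor l m :=
  GradedTensorProduct.lift (fun i : ℕ => ⋀[ℂ]^i (CVec l)) (fun i : ℕ => ⋀[ℂ]^i (CVec m))
    ((GradedTensorProduct.includeLeft (fun i : ℕ => ⋀[ℂ]^i (CVec l))
      (fun i : ℕ => ⋀[ℂ]^i (CVec m))).comp (ExteriorAlgebra.map (s • LinearMap.id)))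
    ((GradedTensorProduct.includeRight (fun i : ℕ => ⋀[ℂ]^i (CVec l))
      (fun i : ℕ => ⋀[ℂ]^i (CVec m))).comp (ExteriorAlgebra.map (t • LinearMap.id)))
    (by
      intro i j A B
      have e1 := GradedTensorProduct.tmul_coe_mul_coe_tmul (R := ℂ)
        (fun i : ℕ => ⋀[ℂ]^i (CVec l)) (fun i : ℕ => ⋀[ℂ]^i (CVec m)) 1
        ⟨_, map_mem_of_mem t j B.2⟩ ⟨_, map_mem_of_mem s i A.2⟩ 1
      have e2 := GradedTensorProduct.tmul_one_mul_one_tmul (R := ℂ)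
        (fun i : ℕ => ⋀[ℂ]^i (CVec l)) (fun i : ℕ => ⋀[ℂ]^i (CVec m))
        (ExteriorAlgebra.map (s • LinearMap.id) (A : ExteriorAlgebra ℂ (CVec l)))
        (ExteriorAlgebra.map (t • LinearMap.id) (B : ExteriorAlgebra ℂ (CVec m)))
      simp only [AlgHom.comp_apply, GradedTensorProduct.includeLeft_apply,
        GradedTensorProduct.includeRight_apply]
      simp only [one_mul, mul_one] at e1
      rw [e2, e1, smul_smul, Int.units_mul_self, one_smul])

theorem split_map_scale (s t : ℂ) (w : ExteriorAlgebra ℂ (CVec l × CVec m)) :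
    split l m (ExteriorAlgebra.map (scale l m s t) w) = scaleTensor l m s t (split l m w) := by
  have : (split l m).comp (ExteriorAlgebra.map (scale l m s t)) =
      (scaleTensor l m s t).comp (split l m) := by
    apply ExteriorAlgebra.hom_ext
    refine LinearMap.ext fun u => ?_
    obtain ⟨v, w⟩ := u
    simp [split, splitι, scale, scaleTensor, GradedTensorProduct.lift_tmul]
    rw [GradedTensorProduct.tmul_one_mul_one_tmul, GradedTensorProduct.tmul_one_mul_one_tmul]
  exact DFunLike.congr_fun this w

theorem bidegreePart_map_scale (a b : ℕ) (s t : ℂ) (w : ExteriorAlgebra ℂ (CVec l × CVec m)) :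
    bidegreePart l m a b (ExteriorAlgebra.map (scale l m s t) w) =
      (s ^ a * t ^ b) • bidegreePart l m a b w := by
  have key : ∀ X : ExteriorAlgebra ℂ (CVec l) ⊗[ℂ] ExteriorAlgebra ℂ (CVec m),
      TensorProduct.map (homPart l a) (homPart m b)
        ((GradedTensorProduct.of ℂ (fun i : ℕ => ⋀[ℂ]^i (CVec l))
          (fun i : ℕ => ⋀[ℂ]^i (CVec m))).symm
          (scaleTensor l m s t (GradedTensorProduct.of ℂ (fun i : ℕ => ⋀[ℂ]^i (CVec l))
          (fun i : ℕ => ⋀[ℂ]^i (CVec m)) X))) =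
      (s ^ a * t ^ b) • TensorProduct.map (homPart l a) (homPart m b) X := by
    intro X
    induction X with
    | zero => simp
    | add x y hx hy => simp only [map_add, hx, hy, smul_add]
    | tmul A B =>
      rw [scaleTensor, GradedTensorProduct.lift_tmul]
      simp only [AlgHom.comp_apply, GradedTensorProduct.includeLeft_apply,
        GradedTensorProduct.includeRight_apply]
      rw [GradedTensorProduct.tmul_one_mul_one_tmul, GradedTensorProduct.of_symm_of,
        TensorProduct.map_tmul, homPart_map, homPart_map, TensorProduct.smul_tmul_smul,
        TensorProduct.map_tmul]
  have h := key ((GradedTensorProduct.of ℂ (fun i : ℕ => ⋀[ℂ]^i (CVec l))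
          (fun i : ℕ => ⋀[ℂ]^i (CVec m))).symm (split l m w))
  rw [GradedTensorProduct.symm_of_of, ← split_map_scale] at h
  exact h

theorem powerCoord_tprod {n : ℕ} (ε : Fin (n + 1) → ℂ) (a : ℕ) (p : ℙ ℂ (CVec n))
    (hp : bar ε p.rep p.rep ≠ 0) (x : p.submodule) (c : ℂ) (hx : x.1 = c • p.rep) :
    powerCoord ε a p (PiTensorProduct.tprod ℂ fun _ => x) = c ^ a := by
  simp only [powerCoord, PiTensorProduct.lift.tprod]
  simp [hx]
  rw [mul_comm c, inv_mul_cancel_left₀ hp]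

theorem extMap_comp {M N P : Type*} [AddCommGroup M] [Module ℂ M] [AddCommGroup N] [Module ℂ N]
    [AddCommGroup P] [Module ℂ P] (f : M →ₗ[ℂ] N) (g : N →ₗ[ℂ] P) (z : ExteriorAlgebra ℂ M) :
    ExteriorAlgebra.map (g ∘ₗ f) z = ExteriorAlgebra.map g (ExteriorAlgebra.map f z) := by
  rw [← ExteriorAlgebra.map_comp_map]
  rfl

theorem tangentToVec_smul (κ : Twistor l m k) (x : κ.p.submodule) (y : κ.q.submodule) (s t : ℂ) :
    tangentToVec κ (s • x) (t • y) = scale l m s t ∘ₗ tangentToVec κ x y := by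
  refine LinearMap.ext fun u => Prod.ext ?_ ?_
  · exact (congrArg (orthoLift (signV l) κ.p (bar_self_ne_zero_V κ.hp (rep_mem _) κ.p.rep_nonzero))
      (map_smul u.1 s x)).trans (map_smul _ s (u.1 x))
  · exact (congrArg (orthoLift (signW m) κ.q (bar_self_ne_zero_W κ.q.rep_nonzero))
      (map_smul u.2 t y)).trans (map_smul _ t (u.2 y))

theorem extToVec_smul (κ : Twistor l m k) (x : κ.p.submodule) (y : κ.q.submodule) (s t : ℂ)
    (z : ⋀[ℂ]^k κ.K) : extToVec κ (s • x) (t • y) z =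
      ExteriorAlgebra.map (scale l m s t) (extToVec κ x y z) := by
  refine (extToVec_apply κ (s • x) (t • y) z).trans ?_
  refine Eq.trans ?_ (extMap_comp (tangentToVec κ x y ∘ₗ κ.K.subtype) (scale l m s t) z.1)
  rw [tangentToVec_smul]
  rfl

theorem map_scale_inV_add_inW (s t : ℂ) (x : CVec l) (y : CVec m) :
    ExteriorAlgebra.map (scale l m s t) (inV x + inW y) = inV (s • x) + inW (t • y) := by
  simp [inV, inW, scale]

theorem bidegreePart_wedge_smul (a b : ℕ) (κ : Twistor l m k) (x : κ.p.submodule)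
    (y : κ.q.submodule) (s t : ℂ) (z : ⋀[ℂ]^k κ.K) :
    bidegreePart l m a b (wedgeFormula (s • x).1 (t • y).1 (extToVec κ (s • x) (t • y) z)) =
      (s ^ a * t ^ b) • bidegreePart l m a b (wedgeFormula x.1 y.1 (extToVec κ x y z)) := by
  have h1 := wedgeFormula_extToVec κ x y z
  have h2 := wedgeFormula_extToVec κ (s • x) (t • y) z
  have h3 := extToVec_smul κ x y s t z
  have h4 := map_scale_inV_add_inW s t x.1 y.1
  generalize extToVec κ x y z = w at h1 h3 ⊢
  generalize extToVec κ (s • x) (t • y) z = w' at h2 h3 ⊢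
  have h5 : ExteriorAlgebra.map (scale l m s t) ((inV x.1 + inW y.1) * w) =
      (inV (s • x).1 + inW (t • y).1) * w' := by
    rw [map_mul, h4, h3]
    rfl
  rw [h1, h2, ← h5]
  exact bidegreePart_map_scale a b s t _

/-- The defining formula of `φ_{a,b}`, for arbitrary representatives `x ∈ p`, `y ∈ q`. -/
theorem plucker_tmul {a b : ℕ} (κ : Twistor l m k) (x : κ.p.submodule) (y : κ.q.submodule)
    (z : ⋀[ℂ]^k κ.K) :
    plucker l m k a b ⟨κ, (z ⊗ₜ[ℂ] (PiTensorProduct.tprod ℂ fun _ => x)) ⊗ₜ[ℂ]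
        (PiTensorProduct.tprod ℂ fun _ => y)⟩ =
      bidegreePart l m a b (wedgeFormula x.1 y.1 (extToVec κ x y z)) := by
  obtain ⟨s, hs⟩ := (mem_submodule_iff κ.p (rep_mem _) κ.p.rep_nonzero x.1).1 x.2
  obtain ⟨t, ht⟩ := (mem_submodule_iff κ.q (rep_mem _) κ.q.rep_nonzero y.1).1 y.2
  have hx : s • (⟨κ.p.rep, rep_mem _⟩ : κ.p.submodule) = x := Subtype.ext hs.symm
  have hy : t • (⟨κ.q.rep, rep_mem _⟩ : κ.q.submodule) = y := Subtype.ext ht.symm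
  have e1 := powerCoord_tprod (signV l) a κ.p
    (bar_self_ne_zero_V κ.hp (rep_mem _) κ.p.rep_nonzero) x s hs
  have e2 := powerCoord_tprod (signW m) b κ.q (bar_self_ne_zero_W κ.q.rep_nonzero) y t ht
  have e3 := bidegreePart_wedge_smul a b κ ⟨κ.p.rep, rep_mem _⟩ ⟨κ.q.rep, rep_mem _⟩ s t z
  rw [hx, hy] at e3
  refine (applyForms_tmul _ _ _ _ _ _).trans ?_
  refine Eq.trans ?_ e3.symm
  exact congrArg₂ (fun c d : ℂ => (c * d) • _) e1 e2

/-! ### Charts of the total space -/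

/-- Coordinates on the total space of the line bundle: affine coordinates `(x, y)` on
`M = H^l × P^m`, affine coordinates on the Grassmannian, and a fibre coordinate. -/
abbrev Coord (l m k : ℕ) : Type :=
  (Fin l ⊕ Fin m → ℂ) × (Fin (l + m - k) → Fin k → ℂ) × ℂ

/-- The open set on which the charts are defined. -/
def chartDomain (l m k : ℕ) : Set (Coord l m k) :=
  {u | ∑ i : Fin l, ‖u.1 (Sum.inl i)‖ ^ 2 < 1}

/-- The point of the manifold `M` with affine coordinates `ζ = (x, y)`, where `y` are the
coordinates in the affine chart `j` of `P^m`: first component. -/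
abbrev basePointV (ζ : Fin l ⊕ Fin m → ℂ) : ℙ ℂ (CVec l) := affinePoint 0 fun i => ζ (Sum.inl i)

/-- Second component of the point of `M` with coordinates `ζ`. -/
abbrev basePointW (j : Fin (m + 1)) (ζ : Fin l ⊕ Fin m → ℂ) : ℙ ℂ (CVec m) :=
  affinePoint j fun i => ζ (Sum.inr i)

/-- The tangent vector `∑ i, v i ∂/∂y_i` of `P^n` at the point `p` with affine coordinates `y` in
the chart `j`: it maps `affine j y ∈ p` to the class of `daffine j v` modulo `p`. -/
def coordTangentP {n : ℕ} (j : Fin (n + 1)) (p : ℙ ℂ (CVec n)) (v : Fin n → ℂ) : TangentP p :=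
  ((LinearMap.proj j : CVec n →ₗ[ℂ] ℂ) ∘ₗ p.submodule.subtype).smulRight
    (p.submodule.mkQ (daffine j v))

/-- The tangent vector of `M` with components `v` in the coordinate frame of the chart `j`. -/
def coordTangent (j : Fin (m + 1)) (p : ℙ ℂ (CVec l)) (q : ℙ ℂ (CVec m)) :
    (Fin l ⊕ Fin m → ℂ) →ₗ[ℂ] TangentM p q where
  toFun v := (coordTangentP 0 p fun i => v (Sum.inl i), coordTangentP j q fun i => v (Sum.inr i))
  map_add' u v := by
    have h : ∀ (n : ℕ) (j : Fin (n + 1)) (p : ℙ ℂ (CVec n)) (u v : Fin n → ℂ),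
        coordTangentP j p (fun i => u i + v i) = coordTangentP j p u + coordTangentP j p v := by
      intro n j p u v
      have : daffine j (fun i => u i + v i) = daffine j u + daffine j v := by
        funext i
        refine Fin.succAboveCases j ?_ (fun i => ?_) i <;> simp [daffine]
      ext w
      simp [coordTangentP, this]
    exact Prod.ext (h _ _ _ _ _) (h _ _ _ _ _)
  map_smul' c v := by
    have h : ∀ (n : ℕ) (j : Fin (n + 1)) (p : ℙ ℂ (CVec n)) (v : Fin n → ℂ),
        coordTangentP j p (fun i => c * v i) = c • coordTangentP j p v := by
      intro n j p v
      have : daffine j (fun i => c * v i) = c • daffine j v := by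
        funext i
        refine Fin.succAboveCases j ?_ (fun i => ?_) i <;> simp [daffine]
      ext w
      simp only [coordTangentP, this, map_smul, LinearMap.smulRight_apply, LinearMap.smul_apply]
      exact smul_comm _ _ _
    exact Prod.ext (h _ _ _ _) (h _ _ _ _)

/-- The matrix whose columns `t_1, …, t_k` are the basis
`t_i = ∂_{σ(i)} + ∑ r, S r i ∂_{σ(r)}` of the `k`-plane with affine Grassmannian coordinates `S`,
in the chart of the Grassmannian given by the partition `σ` of the coordinate directions. -/
def frame (σ : Fin k ⊕ Fin (l + m - k) ≃ Fin l ⊕ Fin m) (S : Fin (l + m - k) → Fin k → ℂ) :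
    Matrix (Fin l ⊕ Fin m) (Fin k) ℂ :=
  Matrix.of fun α i => Sum.elim (fun i' => if i' = i then 1 else 0) (fun r => S r i) (σ.symm α)

/-- The derivative of `frame σ S` in the direction `S'`. -/
def dframe (σ : Fin k ⊕ Fin (l + m - k) ≃ Fin l ⊕ Fin m) (S' : Fin (l + m - k) → Fin k → ℂ) :
    Matrix (Fin l ⊕ Fin m) (Fin k) ℂ :=
  Matrix.of fun α i => Sum.elim (fun _ => 0) (fun r => S' r i) (σ.symm α)

theorem affine_mem {n : ℕ} (j : Fin (n + 1)) (y : Fin n → ℂ) :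
    affine j y ∈ (affinePoint j y).submodule :=
  Submodule.mem_span_singleton_self _

theorem coordTangentP_eq_zero {n : ℕ} (j : Fin (n + 1)) (y : Fin n → ℂ) (v : Fin n → ℂ)
    (h : coordTangentP j (affinePoint j y) v = 0) : v = 0 := by
  have h1 := LinearMap.congr_fun h ⟨affine j y, affine_mem j y⟩
  simp only [coordTangentP, LinearMap.smulRight_apply, LinearMap.comp_apply,
    Submodule.subtype_apply, LinearMap.proj_apply, LinearMap.zero_apply] at h1
  have h2 : affine j y j = 1 := by simp [affine]
  rw [h2, one_smul, Submodule.mkQ_apply, Submodule.Quotient.mk_eq_zero,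
    mem_submodule_iff _ (affine_mem j y) (affine_ne_zero j y)] at h1
  obtain ⟨c, hc⟩ := h1
  have hc0 : c = 0 := by
    have := congrFun hc j
    simpa [daffine, affine, eq_comm] using this
  funext i
  have := congrFun hc (j.succAbove i)
  simpa [daffine, hc0] using this

theorem coordTangent_injective (j : Fin (m + 1)) (ζ : Fin l ⊕ Fin m → ℂ) :
    Function.Injective (coordTangent j (basePointV ζ) (basePointW j ζ)) := by
  rw [injective_iff_map_eq_zero]
  intro v hv
  have h1 := coordTangentP_eq_zero _ _ _ (congrArg Prod.fst hv)
  have h2 := coordTangentP_eq_zero _ _ _ (congrArg Prod.snd hv)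
  funext α
  rcases α with i | i
  · exact congrFun h1 i
  · exact congrFun h2 i

theorem frame_linearIndependent (σ : Fin k ⊕ Fin (l + m - k) ≃ Fin l ⊕ Fin m)
    (S : Fin (l + m - k) → Fin k → ℂ) : LinearIndependent ℂ (fun i => (frame σ S).col i) := by
  rw [Fintype.linearIndependent_iff]
  intro g hg i
  have := congrFun hg (σ (Sum.inl i))
  rw [Finset.sum_apply] at this
  simpa [frame, Matrix.col_apply, Finset.sum_ite_eq] using this

/-- The basis `t_1, …, t_k` as tangent vectors of `M`. -/
def tangentFrame (j : Fin (m + 1)) (σ : Fin k ⊕ Fin (l + m - k) ≃ Fin l ⊕ Fin m)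
    (ζ : Fin l ⊕ Fin m → ℂ) (S : Fin (l + m - k) → Fin k → ℂ) (i : Fin k) :
    TangentM (basePointV ζ) (basePointW j ζ) :=
  coordTangent j _ _ ((frame σ S).col i)

theorem tangentFrame_linearIndependent (j : Fin (m + 1))
    (σ : Fin k ⊕ Fin (l + m - k) ≃ Fin l ⊕ Fin m) (ζ : Fin l ⊕ Fin m → ℂ)
    (S : Fin (l + m - k) → Fin k → ℂ) : LinearIndependent ℂ (tangentFrame j σ ζ S) :=
  (frame_linearIndependent σ S).map' _ (LinearMap.ker_eq_bot.2 (coordTangent_injective j ζ))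

/-- The point of the twistor space with coordinates `u`. -/
def chartPoint (j : Fin (m + 1)) (σ : Fin k ⊕ Fin (l + m - k) ≃ Fin l ⊕ Fin m)
    (u : chartDomain l m k) : Twistor l m k where
  p := basePointV u.1.1
  hp := ⟨_, u.2, rfl⟩
  q := basePointW j u.1.1
  K := Submodule.span ℂ (Set.range (tangentFrame j σ u.1.1 u.1.2.1))
  finrank_K := by
    rw [finrank_span_eq_card (tangentFrame_linearIndependent j σ u.1.1 u.1.2.1), Fintype.card_fin]

theorem tangentFrame_mem (j : Fin (m + 1)) (σ : Fin k ⊕ Fin (l + m - k) ≃ Fin l ⊕ Fin m)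
    (u : chartDomain l m k) (i : Fin k) :
    (show TangentM (chartPoint j σ u).p (chartPoint j σ u).q from
      tangentFrame j σ u.1.1 u.1.2.1 i) ∈ (chartPoint j σ u).K := by
  change _ ∈ Submodule.span ℂ (Set.range (tangentFrame j σ u.1.1 u.1.2.1))
  exact Submodule.subset_span ⟨i, rfl⟩

/-- The basis `t_1, …, t_k` as elements of the `k`-plane. -/
def planeFrame (j : Fin (m + 1)) (σ : Fin k ⊕ Fin (l + m - k) ≃ Fin l ⊕ Fin m)
    (u : chartDomain l m k) (i : Fin k) : (chartPoint j σ u).K :=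
  ⟨_, tangentFrame_mem j σ u i⟩

/-- The chart of the total space: `u = (x, y, S, c)` is sent to the point
`c • (t_1 ∧ … ∧ t_k) ⊗ (1, x)^{⊗a} ⊗ (y_0, …, 1, …, y_m)^{⊗b}` of the line bundle. -/
def chart (a b : ℕ) (j : Fin (m + 1)) (σ : Fin k ⊕ Fin (l + m - k) ≃ Fin l ⊕ Fin m)
    (u : chartDomain l m k) : TotalSpace l m k a b :=
  ⟨chartPoint j σ u,
    u.1.2.2 •
      (exteriorPower.ιMulti ℂ k (planeFrame j σ u) ⊗ₜ[ℂ]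
        (PiTensorProduct.tprod ℂ fun _ : Fin a =>
          (⟨_, affine_mem 0 _⟩ : (chartPoint j σ u).p.submodule)) ⊗ₜ[ℂ]
        (PiTensorProduct.tprod ℂ fun _ : Fin b =>
          (⟨_, affine_mem j _⟩ : (chartPoint j σ u).q.submodule)))⟩

/-! ### The Kähler metric and its connection -/

/-- The Wirtinger derivative `∂f/∂ζ_α`. -/
def dz {ι : Type*} [Fintype ι] [DecidableEq ι] (f : (ι → ℂ) → ℂ) (α : ι) (ζ : ι → ℂ) : ℂ :=
  (fderiv ℝ f ζ (Pi.single α 1) - I * fderiv ℝ f ζ (Pi.single α I)) / 2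

/-- The Wirtinger derivative `∂f/∂ζ̄_α`. -/
def dzBar {ι : Type*} [Fintype ι] [DecidableEq ι] (f : (ι → ℂ) → ℂ) (α : ι) (ζ : ι → ℂ) : ℂ :=
  (fderiv ℝ f ζ (Pi.single α 1) + I * fderiv ℝ f ζ (Pi.single α I)) / 2

/-- The Kähler potential `-log (1 - ∑ |x_i|²) + log (1 + ∑ |y_j|²)` of `M` in affine
coordinates. -/
def kahlerPotential (ζ : Fin l ⊕ Fin m → ℂ) : ℝ :=
  -Real.log (1 - ∑ i : Fin l, ‖ζ (Sum.inl i)‖ ^ 2) +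
    Real.log (1 + ∑ i : Fin m, ‖ζ (Sum.inr i)‖ ^ 2)

/-- The Kähler metric `h_{αβ̄} = ∂_α ∂̄_β F`, where `F` is the Kähler potential, so that the Kähler
form is `√-1 ∂∂̄F = √-1 ∑ h_{αβ̄} dζ_α ∧ dζ̄_β`. -/
def metric (ζ : Fin l ⊕ Fin m → ℂ) : Matrix (Fin l ⊕ Fin m) (Fin l ⊕ Fin m) ℂ :=
  Matrix.of fun α β => dz (dzBar (fun ξ => (kahlerPotential ξ : ℂ)) β) α ζ

/-- The Christoffel symbols `Γ^γ_{αβ} = ∑ δ, (∂_α h_{βδ̄}) h^{δ̄γ}` of the Kähler metric. -/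
def christoffel (ζ : Fin l ⊕ Fin m → ℂ) (γ α β : Fin l ⊕ Fin m) : ℂ :=
  ∑ δ, dz (fun ξ => metric ξ β δ) α ζ * (metric ζ)⁻¹ δ γ

/-- The connection matrix in the direction `ζ'`: along a curve with velocity `ζ'`, the covariant
derivative of a vector field `w` of type `(1,0)` is `w' + connectionMatrix ζ ζ' *ᵥ w`. -/
def connectionMatrix (ζ ζ' : Fin l ⊕ Fin m → ℂ) :
    Matrix (Fin l ⊕ Fin m) (Fin l ⊕ Fin m) ℂ :=
  Matrix.of fun γ β => ∑ α, christoffel ζ γ α β * ζ' α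

/-- The orthogonal projection, with respect to the metric at `ζ`, to the span of the columns
of `T`: the vector `w` goes to `T (T^* G T)⁻¹ T^* G w`, where `v^* G w = ∑ h_{αβ̄} w_α v̄_β` is the
Hermitian product. -/
def orthoProj (ζ : Fin l ⊕ Fin m → ℂ) (T : Matrix (Fin l ⊕ Fin m) (Fin k) ℂ) :
    Matrix (Fin l ⊕ Fin m) (Fin l ⊕ Fin m) ℂ :=
  T * (Tᴴ * (metric ζ)ᵀ * T)⁻¹ * Tᴴ * (metric ζ)ᵀ

/-! ### The almost complex structure -/

/-- The covariant derivatives of the basis `t_1, …, t_k` along a curve in the twistor space with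
velocity `(ζ', S')`, as the columns of a matrix. -/
def covFrame (σ : Fin k ⊕ Fin (l + m - k) ≃ Fin l ⊕ Fin m) (ζ : Fin l ⊕ Fin m → ℂ)
    (S : Fin (l + m - k) → Fin k → ℂ) (ζ' : Fin l ⊕ Fin m → ℂ)
    (S' : Fin (l + m - k) → Fin k → ℂ) : Matrix (Fin l ⊕ Fin m) (Fin k) ℂ :=
  dframe σ S' + connectionMatrix ζ ζ' * frame σ S

/-- The vertical component of the tangent vector `(ζ', S')` of the twistor space, for the splitting
`T Z_k(M) = T_V ⊕ T_H` defined by the connection. It is the linear map `K → T^{(1,0)}M / K`,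
`t_i ↦ ∇ t_i mod K`, written in the basis `t_i` of `K` and the basis `∂_{σ(r)}` of
`T^{(1,0)}M / K`; the class modulo `K` of a vector `w` has components
`w_{σ(r)} - ∑ p, S r p * w_{σ(p)}`. -/
def verticalPart (σ : Fin k ⊕ Fin (l + m - k) ≃ Fin l ⊕ Fin m) (ζ : Fin l ⊕ Fin m → ℂ)
    (S : Fin (l + m - k) → Fin k → ℂ) (ζ' : Fin l ⊕ Fin m → ℂ)
    (S' : Fin (l + m - k) → Fin k → ℂ) : Fin (l + m - k) → Fin k → ℂ := fun r i =>
  covFrame σ ζ S ζ' S' (σ (Sum.inr r)) i -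
    ∑ p, S r p * covFrame σ ζ S ζ' S' (σ (Sum.inl p)) i

/-- The complex structure of the horizontal space `T^{(1,0)}M = K ⊕ K^⊥`: the conjugate structure,
multiplication by `-√-1`, on `K`, and multiplication by `√-1` on `K^⊥`. -/
def horizontalJ (σ : Fin k ⊕ Fin (l + m - k) ≃ Fin l ⊕ Fin m) (ζ : Fin l ⊕ Fin m → ℂ)
    (S : Fin (l + m - k) → Fin k → ℂ) (ζ' : Fin l ⊕ Fin m → ℂ) : Fin l ⊕ Fin m → ℂ :=
  let P := orthoProj ζ (frame σ S)
  I • (ζ' - P *ᵥ ζ') - I • (P *ᵥ ζ')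

/-- The connection form of the canonical connection of a line bundle spanned by the
vector `affine j y`, namely of the tautological bundle with the metric induced by the Hermitian
form with signs `ε`, in the direction `v`: `(∇s, s)/(s, s)` for `s = affine j y`. -/
def tautForm {n : ℕ} (ε : Fin (n + 1) → ℂ) (j : Fin (n + 1)) (y v : Fin n → ℂ) : ℂ :=
  bar ε (affine j y) (daffine j v) / bar ε (affine j y) (affine j y)

/-- The connection form of the canonical connection of `L_{Z_k(M)} = Λ^k K`, in the frame
`t_1 ∧ … ∧ t_k`: the trace of the connection `t_i ↦ (orthogonal projection of ∇ t_i to K)` of the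
tautological bundle `K` over the Grassmannian bundle. The component of a vector of `K` along `t_i`
is its coordinate `σ(i)`. -/
def grassForm (σ : Fin k ⊕ Fin (l + m - k) ≃ Fin l ⊕ Fin m) (ζ : Fin l ⊕ Fin m → ℂ)
    (S : Fin (l + m - k) → Fin k → ℂ) (ζ' : Fin l ⊕ Fin m → ℂ)
    (S' : Fin (l + m - k) → Fin k → ℂ) : ℂ :=
  ∑ i, (orthoProj ζ (frame σ S) * covFrame σ ζ S ζ' S') (σ (Sum.inl i)) i

/-- The connection form of `L_{Z_k(M)} ⊗ p_1^* L^a ⊗ p_2^* L^b` in the frame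
`(t_1 ∧ … ∧ t_k) ⊗ (1, x)^{⊗a} ⊗ (y_0, …, 1, …, y_m)^{⊗b}`. -/
def lineForm (a b : ℕ) (j : Fin (m + 1)) (σ : Fin k ⊕ Fin (l + m - k) ≃ Fin l ⊕ Fin m)
    (ζ : Fin l ⊕ Fin m → ℂ) (S : Fin (l + m - k) → Fin k → ℂ) (ζ' : Fin l ⊕ Fin m → ℂ)
    (S' : Fin (l + m - k) → Fin k → ℂ) : ℂ :=
  grassForm σ ζ S ζ' S' +
    a * tautForm (signV l) 0 (fun i => ζ (Sum.inl i)) (fun i => ζ' (Sum.inl i)) +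
    b * tautForm (signW m) j (fun i => ζ (Sum.inr i)) (fun i => ζ' (Sum.inr i))

/-- The almost complex structure of the twistor space, in a chart: `(ζ'', S'') = J (ζ', S')` is the
tangent vector whose horizontal component is `horizontalJ ζ'` and whose vertical component is
`√-1` times the vertical component of `(ζ', S')`. -/
def twistorJ (σ : Fin k ⊕ Fin (l + m - k) ≃ Fin l ⊕ Fin m) (ζ : Fin l ⊕ Fin m → ℂ)
    (S : Fin (l + m - k) → Fin k → ℂ) (ζ' : Fin l ⊕ Fin m → ℂ)
    (S' : Fin (l + m - k) → Fin k → ℂ) :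
    (Fin l ⊕ Fin m → ℂ) × (Fin (l + m - k) → Fin k → ℂ) :=
  let ζ'' := horizontalJ σ ζ S ζ'
  (ζ'', I • verticalPart σ ζ S ζ' S' - verticalPart σ ζ S ζ'' 0)

/-- The almost complex structure of the total space of the line bundle, in a chart, induced by that
of the twistor space and the connection: the tangent vector `(ζ'', S'', c'') = J (ζ', S', c')` lies
over `twistorJ (ζ', S')` and its vertical component `c'' + c * lineForm (ζ'', S'')` is `√-1` times
the vertical component of `(ζ', S', c')`. -/
def totalJ (a b : ℕ) (j : Fin (m + 1)) (σ : Fin k ⊕ Fin (l + m - k) ≃ Fin l ⊕ Fin m)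
    (u v : Coord l m k) : Coord l m k :=
  let w := twistorJ σ u.1 u.2.1 v.1 v.2.1
  (w.1, w.2,
    I * (v.2.2 + u.2.2 * lineForm a b j σ u.1 u.2.1 v.1 v.2.1) -
      u.2.2 * lineForm a b j σ u.1 u.2.1 w.1 w.2)

/-- The coordinate expression of a complex function on the total space in a chart (extended by zero
outside the open set `chartDomain`). -/
def inChart {a b : ℕ} (f : TotalSpace l m k a b → ℂ) (j : Fin (m + 1))
    (σ : Fin k ⊕ Fin (l + m - k) ≃ Fin l ⊕ Fin m) (u : Coord l m k) : ℂ :=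
  open Classical in if h : u ∈ chartDomain l m k then f (chart a b j σ ⟨u, h⟩) else 0

/-- A map from the total space to a finite-dimensional complex vector space is holomorphic if each
of its components `f` (its composition with a complex linear form) is smooth and satisfies the
Cauchy–Riemann equation `df ∘ J = √-1 df` in all charts. -/
def IsHolomorphic {a b : ℕ} {F : Type*} [AddCommGroup F] [Module ℂ F]
    (Φ : TotalSpace l m k a b → F) : Prop :=
  ∀ (lam : Module.Dual ℂ F) (j : Fin (m + 1)) (σ : Fin k ⊕ Fin (l + m - k) ≃ Fin l ⊕ Fin m),
    ∀ u ∈ chartDomain l m k,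
      ContDiffAt ℝ ∞ (inChart (fun e => lam (Φ e)) j σ) u ∧
        ∀ v : Coord l m k,
          fderiv ℝ (inChart (fun e => lam (Φ e)) j σ) u (totalJ a b j σ u v) =
            I * fderiv ℝ (inChart (fun e => lam (Φ e)) j σ) u v

/-! ### The charts cover the total space -/

theorem exists_affinePoint {n : ℕ} (q : ℙ ℂ (CVec n)) : ∃ j y, q = affinePoint j y := by
  obtain ⟨j, hj⟩ := Function.ne_iff.1 q.rep_nonzero
  refine ⟨j, fun i => (q.rep j)⁻¹ * q.rep (j.succAbove i), ?_⟩
  rw [← q.mk_rep, affinePoint, Projectivization.mk_eq_mk_iff']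
  refine ⟨q.rep j, ?_⟩
  rw [q.mk_rep]
  funext i
  refine Fin.succAboveCases j ?_ (fun i => ?_) i
  · simp [affine]
  · have : q.rep j ≠ 0 := hj
    simp [affine, this]

theorem coordTangentP_surjective {n : ℕ} (j : Fin (n + 1)) (y : Fin n → ℂ)
    (f : TangentP (affinePoint j y)) : ∃ v, coordTangentP j (affinePoint j y) v = f := by
  obtain ⟨w, hw⟩ := Submodule.mkQ_surjective _ (f ⟨affine j y, affine_mem j y⟩)
  refine ⟨fun i => w (j.succAbove i) - w j * y i, ?_⟩
  have h1 : affine j y j = 1 := by simp [affine]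
  have h2 : daffine j (fun i => w (j.succAbove i) - w j * y i) = w - w j • affine j y := by
    funext i
    refine Fin.succAboveCases j ?_ (fun i => ?_) i <;> simp [affine, daffine]
  refine LinearMap.ext fun u => ?_
  obtain ⟨c, hc⟩ := (mem_submodule_iff _ (affine_mem j y) (affine_ne_zero j y) u.1).1 u.2
  have hu : u = c • ⟨affine j y, affine_mem j y⟩ := Subtype.ext hc
  have h3 : (affinePoint j y).submodule.mkQ (affine j y) = 0 := by
    rw [Submodule.mkQ_apply, Submodule.Quotient.mk_eq_zero]
    exact affine_mem j y
  rw [hu, map_smul, map_smul, ← hw]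
  congr 1
  simp only [coordTangentP, LinearMap.smulRight_apply, LinearMap.comp_apply,
    Submodule.subtype_apply, LinearMap.proj_apply]
  rw [h1, one_smul, h2, map_sub, map_smul, h3, smul_zero, sub_zero]

theorem coordTangent_surjective (j : Fin (m + 1)) (ζ : Fin l ⊕ Fin m → ℂ) :
    Function.Surjective (coordTangent j (basePointV ζ) (basePointW j ζ)) := by
  rintro ⟨f, g⟩
  obtain ⟨v, hv⟩ := coordTangentP_surjective _ _ f
  obtain ⟨w, hw⟩ := coordTangentP_surjective _ _ g
  exact ⟨Sum.elim v w, Prod.ext hv hw⟩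

theorem exists_frame (N : Submodule ℂ (Fin l ⊕ Fin m → ℂ)) (hN : Module.finrank ℂ N = k) :
    ∃ (σ : Fin k ⊕ Fin (l + m - k) ≃ Fin l ⊕ Fin m) (S : Fin (l + m - k) → Fin k → ℂ),
      Submodule.span ℂ (Set.range fun i => (frame σ S).col i) = N := by
  classical
  let f : Fin l ⊕ Fin m → Module.Dual ℂ N := fun α => LinearMap.proj α ∘ₗ N.subtype
  have hf : Submodule.span ℂ (Set.range f) = ⊤ := by
    have : (Submodule.span ℂ (Set.range f)).dualCoannihilator = ⊥ := by
      rw [eq_bot_iff]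
      intro w hw
      rw [Submodule.mem_dualCoannihilator] at hw
      exact Subtype.ext (funext fun α => hw (f α) (Submodule.subset_span ⟨α, rfl⟩))
    rw [← Subspace.dualCoannihilator_dualAnnihilator_eq (W := Submodule.span ℂ (Set.range f)),
      this, Submodule.dualAnnihilator_bot]
  obtain ⟨κ, e, he, hs, hi⟩ := exists_linearIndependent' ℂ f
  rw [hf] at hs
  have : Finite κ := Finite.of_injective e he
  have : Fintype κ := Fintype.ofFinite κ
  have hc : Fintype.card κ = k := by
    have := finrank_span_eq_card hi
    rw [hs, finrank_top, Subspace.dual_finrank_eq, hN] at this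
    exact this.symm
  let e0 : Fin k ≃ κ := (Fintype.equivFinOfCardEq hc).symm
  let g : Fin k → Fin l ⊕ Fin m := e ∘ e0
  have hg : Function.Injective g := he.comp e0.injective
  have hcard : Fintype.card {α // ¬ α ∈ Set.range g} = l + m - k := by
    rw [Fintype.card_subtype_compl]
    have h1 : Fintype.card {α // α ∈ Set.range g} = k := by
      have := Set.card_range_of_injective hg
      rw [Fintype.card_fin] at this
      convert this
    rw [h1]; simp
  let σ : Fin k ⊕ Fin (l + m - k) ≃ Fin l ⊕ Fin m :=
    ((Equiv.ofInjective g hg).sumCongr (Fintype.equivFinOfCardEq hcard).symm).trans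
      (Equiv.sumCompl (· ∈ Set.range g))
  have hσ : ∀ i, σ (Sum.inl i) = g i := fun i => rfl
  let R : N →ₗ[ℂ] (Fin k → ℂ) := LinearMap.pi fun i => f (g i)
  have hR : Function.Injective R := by
    rw [injective_iff_map_eq_zero]
    intro w hw
    have h1 : ∀ φ : Module.Dual ℂ N, φ w = 0 := by
      intro φ
      have : φ ∈ Submodule.span ℂ (Set.range (f ∘ e)) := by rw [hs]; trivial
      induction this using Submodule.span_induction with
      | mem x hx =>
        obtain ⟨i, rfl⟩ := hx
        have := congrFun hw (e0.symm i)
        simpa [R, g] using this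
      | zero => rfl
      | add x y _ _ hx hy => rw [LinearMap.add_apply, hx, hy, add_zero]
      | smul c x _ hx => rw [LinearMap.smul_apply, hx, smul_zero]
    exact Subtype.ext (funext fun α => h1 (f α))
  have hR2 : Function.Surjective R :=
    (LinearMap.injective_iff_surjective_of_finrank_eq_finrank (by simp [hN])).1 hR
  choose t ht using fun i : Fin k => hR2 (Pi.single i 1)
  refine ⟨σ, fun r i => (t i).1 (σ (Sum.inr r)), ?_⟩
  have hcol : ∀ i, (frame σ fun r i => (t i).1 (σ (Sum.inr r))).col i = (t i).1 := by
    intro i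
    funext α
    obtain ⟨α, rfl⟩ := σ.surjective α
    rcases α with i' | r
    · have h1 : (t i).1 (σ (Sum.inl i')) = Pi.single (M := fun _ => ℂ) i 1 i' :=
        congrFun (ht i) i'
      rw [h1]
      simp [frame, Matrix.col_apply, Pi.single_apply]
    · simp [frame, Matrix.col_apply]
  have hli := frame_linearIndependent σ fun r i => (t i).1 (σ (Sum.inr r))
  refine Submodule.eq_of_le_of_finrank_eq ?_ ?_
  · rw [Submodule.span_le]
    rintro _ ⟨i, rfl⟩
    have := (t i).2
    rwa [← hcol] at this
  · rw [finrank_span_eq_card hli, Fintype.card_fin, hN]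

theorem exists_smul_ιMulti {M : Type*} [AddCommGroup M] [Module ℂ M] (v : Fin k → M)
    (hv : LinearIndependent ℂ v) (hs : ⊤ ≤ Submodule.span ℂ (Set.range v)) (z : ⋀[ℂ]^k M) :
    ∃ c : ℂ, z = c • exteriorPower.ιMulti ℂ k v := by
  let B := Module.Basis.mk hv hs
  have h : ∀ u : Fin k → M, exteriorPower.ιMulti ℂ k u =
      B.det u • exteriorPower.ιMulti ℂ k v := by
    intro u
    have : (exteriorPower.ιMulti ℂ k : M [⋀^Fin k]→ₗ[ℂ] ⋀[ℂ]^k M) =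
        (LinearMap.toSpanSingleton ℂ _ (exteriorPower.ιMulti ℂ k v)).compAlternatingMap B.det := by
      refine Module.Basis.ext_alternating B fun w hw => ?_
      obtain ⟨τ, rfl⟩ : ∃ τ : Equiv.Perm (Fin k), ⇑τ = w :=
        ⟨Equiv.ofBijective w (Finite.injective_iff_bijective.1 hw), rfl⟩
      have e1 : (fun i => B (τ i)) = v ∘ τ := by
        funext i; simp [B]
      have e2 : B.det (v ∘ τ) = (τ.sign : ℤ) := by
        have : B.det v = 1 := by
          have e3 : v = B := by funext i; simp [B]
          rw [e3, Module.Basis.det_self]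
        rw [AlternatingMap.map_perm, this]
        simp [Units.smul_def]
      rw [e1, LinearMap.compAlternatingMap_apply, e2, AlternatingMap.map_perm,
        LinearMap.toSpanSingleton_apply, Units.smul_def, Int.cast_smul_eq_zsmul]
    exact DFunLike.congr_fun this u
  have hz : z ∈ Submodule.span ℂ (Set.range (exteriorPower.ιMulti ℂ k : (Fin k → M) → _)) := by
    rw [exteriorPower.ιMulti_span]; trivial
  induction hz using Submodule.span_induction with
  | mem x hx => obtain ⟨u, rfl⟩ := hx; exact ⟨_, h u⟩
  | zero => exact ⟨0, by simp⟩
  | add x y _ _ hx hy =>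
    obtain ⟨c, rfl⟩ := hx
    obtain ⟨d, rfl⟩ := hy
    exact ⟨c + d, by rw [add_smul]⟩
  | smul c x _ hx => obtain ⟨d, rfl⟩ := hx; exact ⟨c * d, by rw [mul_smul]⟩

theorem exists_smul_tprod {L : Type*} [AddCommGroup L] [Module ℂ L] (a : ℕ) (x : L)
    (hx : ∀ v : L, ∃ c : ℂ, v = c • x) (z : ⨂[ℂ]^a L) :
    ∃ c : ℂ, z = c • PiTensorProduct.tprod ℂ fun _ : Fin a => x := by
  have hz : z ∈ Submodule.span ℂ (Set.range (PiTensorProduct.tprod ℂ (s := fun _ : Fin a => L))) := by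
    rw [PiTensorProduct.span_tprod_eq_top]; trivial
  induction hz using Submodule.span_induction with
  | mem u hu =>
    obtain ⟨v, rfl⟩ := hu
    choose c hc using fun i => hx (v i)
    refine ⟨∏ i, c i, ?_⟩
    rw [← MultilinearMap.map_smul_univ]
    congr 1
    funext i
    exact hc i
  | zero => exact ⟨0, by simp⟩
  | add x y _ _ hx hy =>
    obtain ⟨c, rfl⟩ := hx
    obtain ⟨d, rfl⟩ := hy
    exact ⟨c + d, by rw [add_smul]⟩
  | smul c x _ hx => obtain ⟨d, rfl⟩ := hx; exact ⟨c * d, by rw [mul_smul]⟩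

theorem exists_smul_tmul {A B : Type*} [AddCommMonoid A] [Module ℂ A] [AddCommMonoid B] [Module ℂ B]
    (u : A) (v : B) (hu : ∀ x : A, ∃ c : ℂ, x = c • u) (hv : ∀ y : B, ∃ c : ℂ, y = c • v)
    (z : A ⊗[ℂ] B) : ∃ c : ℂ, z = c • (u ⊗ₜ[ℂ] v) := by
  induction z with
  | zero => exact ⟨0, by simp⟩
  | tmul x y =>
    obtain ⟨c, rfl⟩ := hu x
    obtain ⟨d, rfl⟩ := hv y
    exact ⟨c * d, by rw [TensorProduct.smul_tmul_smul]⟩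
  | add x y hx hy =>
    obtain ⟨c, rfl⟩ := hx
    obtain ⟨d, rfl⟩ := hy
    exact ⟨c + d, by rw [add_smul]⟩

theorem exists_smul_tprod_line {n : ℕ} (a : ℕ) (p : ℙ ℂ (CVec n)) (x : p.submodule) (hx : x.1 ≠ 0)
    (z : ⨂[ℂ]^a p.submodule) : ∃ c : ℂ, z = c • PiTensorProduct.tprod ℂ fun _ : Fin a => x := by
  refine exists_smul_tprod a x (fun v => ?_) z
  obtain ⟨c, hc⟩ := (mem_submodule_iff p x.2 hx v.1).1 v.2
  exact ⟨c, Subtype.ext hc⟩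

instance (p : ℙ ℂ (CVec l)) (q : ℙ ℂ (CVec m)) : Module.Finite ℂ (TangentM p q) :=
  inferInstanceAs (Module.Finite ℂ (TangentP p × TangentP q))

theorem exists_smul_plane (κ : Twistor l m k) (v : Fin k → κ.K)
    (h : LinearIndependent ℂ fun i => (v i : TangentM κ.p κ.q)) (z : ⋀[ℂ]^k κ.K) :
    ∃ c : ℂ, z = c • exteriorPower.ιMulti ℂ k v := by
  have hv : LinearIndependent ℂ v := LinearIndependent.of_comp κ.K.subtype h
  refine exists_smul_ιMulti v hv (le_of_eq (Eq.symm ?_)) z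
  refine Submodule.eq_top_of_finrank_eq ?_
  rw [finrank_span_eq_card hv, Fintype.card_fin]
  exact κ.finrank_K.symm

theorem exists_fiber_coord (a b : ℕ) (j : Fin (m + 1))
    (σ : Fin k ⊕ Fin (l + m - k) ≃ Fin l ⊕ Fin m) (u : chartDomain l m k)
    (t : LineFiber a b (chartPoint j σ u)) : ∃ c : ℂ, t = c •
      (exteriorPower.ιMulti ℂ k (planeFrame j σ u) ⊗ₜ[ℂ]
        (PiTensorProduct.tprod ℂ fun _ : Fin a =>
          (⟨_, affine_mem 0 _⟩ : (chartPoint j σ u).p.submodule)) ⊗ₜ[ℂ]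
        (PiTensorProduct.tprod ℂ fun _ : Fin b =>
          (⟨_, affine_mem j _⟩ : (chartPoint j σ u).q.submodule))) := by
  have h1 := exists_smul_plane (chartPoint j σ u) (planeFrame j σ u)
    (tangentFrame_linearIndependent j σ u.1.1 u.1.2.1)
  have h2 := exists_smul_tprod_line a (chartPoint j σ u).p ⟨_, affine_mem 0 _⟩
    (affine_ne_zero 0 fun i => u.1.1 (Sum.inl i))
  have h3 := exists_smul_tprod_line b (chartPoint j σ u).q ⟨_, affine_mem j _⟩
    (affine_ne_zero j fun i => u.1.1 (Sum.inr i))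
  exact exists_smul_tmul _ _ (exists_smul_tmul _ _ h1 h2) h3 t

/-- The images of the charts cover the total space. -/
theorem exists_chart (a b : ℕ) (e : TotalSpace l m k a b) :
    ∃ (j : Fin (m + 1)) (σ : Fin k ⊕ Fin (l + m - k) ≃ Fin l ⊕ Fin m) (u : chartDomain l m k),
      chart a b j σ u = e := by
  obtain ⟨⟨p, hp, q, K, hK⟩, t⟩ := e
  obtain ⟨x, hx, rfl⟩ := id hp
  obtain ⟨j, y, rfl⟩ := exists_affinePoint q
  let ζ : Fin l ⊕ Fin m → ℂ := Sum.elim x y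
  let T : (Fin l ⊕ Fin m → ℂ) ≃ₗ[ℂ] TangentM (affinePoint 0 x) (affinePoint j y) :=
    LinearEquiv.ofBijective (coordTangent j (affinePoint 0 x) (affinePoint j y))
      ⟨coordTangent_injective j ζ, coordTangent_surjective j ζ⟩
  obtain ⟨σ, S, hS⟩ := exists_frame (k := k) (K.map T.symm.toLinearMap)
    ((LinearEquiv.finrank_map_eq T.symm K).trans hK)
  have hKS : Submodule.span ℂ (Set.range fun i => T ((frame σ S).col i)) = K := by
    have : (Set.range fun i => T ((frame σ S).col i)) =
        T.toLinearMap '' Set.range fun i => (frame σ S).col i := by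
      rw [← Set.range_comp]; rfl
    rw [this, Submodule.span_image, hS, ← Submodule.map_comp]
    simp
  subst hKS
  let u0 : chartDomain l m k := ⟨(ζ, S, 0), hx⟩
  obtain ⟨c, hc⟩ := exists_fiber_coord a b j σ u0 t
  refine ⟨j, σ, ⟨(ζ, S, c), hx⟩, ?_⟩
  refine Eq.trans ?_ (congrArg (Sigma.mk (chartPoint j σ u0)) hc.symm)
  rfl

end BochnerTwistor

end

noncomputable section

open scoped TensorProduct LinearAlgebra.Projectivization ContDiff ComplexConjugate Matrix ComplexOrder
open Complex

namespace BochnerTwistor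

variable {l m k : ℕ}

/-! In a chart, each component of `φ_{a,b}` is `c * G(X + Y, t̂_1, …, t̂_k)`. Here `c` is the fibre
coordinate and `X`, `Y` are the homogeneous coordinate vectors of the base point. The vectors `t_i`
form the frame of `K`, and `ŵ ∈ p^⊥ ⊕ q^⊥` is the vector attached to a tangent vector `w`. The
alternating form `G` is a linear form applied to the `(a, b)` part of a wedge product
(`plucker_chart`). The two interior multiplications contribute nothing, since `t̂_i` is orthogonal
to `X` and `Y`. Smoothness is then clear, and the derivative follows from the Leibniz rule.

Let `θ_V`, `θ_W` be the connection forms of the tautological bundles and `h_V`, `h_W` the two parts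
of the Kähler metric `h = h_V + h_W`. Along a curve with base velocity `ζ'`, the structure equations
are `(X + Y)' = ζ̂' + D(X + Y)` and `(ŵ)' = (∇w)^ + (h_V(w, ζ') X, -h_W(w, ζ') Y) + D ŵ`, where `D`
scales `V` by `θ_V(ζ')` and `W` by `θ_W(ζ')` (`hasDerivAt_baseVec`, `hasDerivAt_tangentVec`). They
rest on closed forms of the metric and of its Christoffel symbols (`metric_apply`,
`connectionMatrix_mulVec`).

Inserted in `G`, these equations simplify in four ways. The `D` terms add up to `(a θ_V + b θ_W) G`,
because `G` has bidegree `(a, b)`. In the first slot the `K`-component of `ζ'` drops out, being a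
combination of the other vectors. In the slot of `t_i` the `K`-component of `∇t_i` leaves only its
`i`-th coordinate, which yields the connection form of `Λ^k K`. Modulo `X + Y`, the normal term
becomes `h(t_i, ζ') X`: the opposite signs on the two factors are what produces the full metric
(`update_secondForm`).

Hence, with `ω` the connection form of the line bundle, the derivative is `(c' + c ω) G` plus `c`
times an expression that is complex linear in the `K^⊥`-component of `ζ'`, the numbers `h(t_i, ζ')`,
and the vertical part (`fderiv_chart`). The almost complex structure multiplies each of these by
`√-1`. For `h(t_i, ζ')` this is where the conjugate structure on `K` enters: only the `K`-component
of `ζ'` contributes, it is multiplied by `-√-1`, and `h` is antilinear in that slot. -/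

/-! ### The weighted sesquilinear form `∑ χ u v̄` and the metrics built from it -/

section Pairing

variable {ι : Type*} [Fintype ι]

/-- The sesquilinear form `∑ α, χ α * u α * conj (v α)`. -/
def pair (χ : ι → ℝ) (u v : ι → ℂ) : ℂ := ∑ α, χ α * u α * conj (v α)

theorem pair_add_left (χ : ι → ℝ) (u u' v : ι → ℂ) :
    pair χ (u + u') v = pair χ u v + pair χ u' v := by
  simp [pair, mul_add, add_mul, Finset.sum_add_distrib]

theorem pair_smul_left (χ : ι → ℝ) (c : ℂ) (u v : ι → ℂ) :
    pair χ (c • u) v = c * pair χ u v := by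
  simp only [pair, Finset.mul_sum]
  exact Finset.sum_congr rfl fun i _ => by simp; ring

theorem pair_smul_right (χ : ι → ℝ) (c : ℂ) (u v : ι → ℂ) :
    pair χ u (c • v) = conj c * pair χ u v := by
  simp only [pair, Finset.mul_sum]
  exact Finset.sum_congr rfl fun i _ => by simp; ring

theorem conj_pair (χ : ι → ℝ) (u v : ι → ℂ) : conj (pair χ u v) = pair χ v u := by
  simp only [pair, map_sum]
  exact Finset.sum_congr rfl fun i _ => by simp; ring

theorem pair_self (χ : ι → ℝ) (u : ι → ℂ) :
    pair χ u u = ((∑ α, χ α * ‖u α‖ ^ 2 : ℝ) : ℂ) := by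
  simp only [pair, ofReal_sum]
  exact Finset.sum_congr rfl fun i _ => by
    rw [mul_assoc, Complex.mul_conj']; push_cast; ring

theorem _root_.HasDerivAt.pair {χ : ι → ℝ} {u v : ℝ → ι → ℂ} {u' v' : ι → ℂ} {t : ℝ}
    (hu : HasDerivAt u u' t) (hv : HasDerivAt v v' t) :
    HasDerivAt (fun s => pair χ (u s) (v s)) (pair χ u' (v t) + pair χ (u t) v') t := by
  have h : ∀ α ∈ Finset.univ, HasDerivAt (fun s => χ α * u s α * conj (v s α))
      (χ α * u' α * conj (v t α) + χ α * u t α * conj (v' α)) t := fun α _ =>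
    (((hasDerivAt_pi.1 hu α).const_mul _)).mul (hasDerivAt_pi.1 hv α).star
  have := HasDerivAt.fun_sum h
  rwa [Finset.sum_add_distrib] at this

theorem _root_.ContDiffAt.pair {E : Type*} [NormedAddCommGroup E] [NormedSpace ℝ E] {χ : ι → ℝ}
    {u v : E → ι → ℂ} {x : E} {n : WithTop ℕ∞} (hu : ContDiffAt ℝ n u x)
    (hv : ContDiffAt ℝ n v x) : ContDiffAt ℝ n (fun y => pair χ (u y) (v y)) x := by
  refine ContDiffAt.sum fun α _ => ContDiffAt.mul ?_ ?_
  · exact contDiffAt_const.mul (contDiffAt_pi.1 hu α)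
  · exact (Complex.conjCLE.contDiff.contDiffAt (x := v x α)).comp x (contDiffAt_pi.1 hv α)

/-- The function `1 + s ∑ χ |ζ|²`. -/
def rad (s : ℝ) (χ : ι → ℝ) (ζ : ι → ℂ) : ℂ := 1 + s * pair χ ζ ζ

/-- The real number `1 + s ∑ χ |ζ|²`. -/
def realRad (s : ℝ) (χ : ι → ℝ) (ζ : ι → ℂ) : ℝ := 1 + s * ∑ α, χ α * ‖ζ α‖ ^ 2

theorem rad_eq (s : ℝ) (χ : ι → ℝ) (ζ : ι → ℂ) : rad s χ ζ = realRad s χ ζ := by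
  simp [rad, realRad, pair_self]

theorem rad_ne_zero {s : ℝ} {χ : ι → ℝ} {ζ : ι → ℂ} (h : 0 < realRad s χ ζ) : rad s χ ζ ≠ 0 := by
  rw [rad_eq]; exact ofReal_ne_zero.2 h.ne'

/-- The `(1,0)`-form `∂ log (1 + s ∑ χ |ζ|²)`. -/
def theta (s : ℝ) (χ : ι → ℝ) (ζ v : ι → ℂ) : ℂ := s * pair χ v ζ / rad s χ ζ

/-- The Hermitian form with Kähler potential `s log (1 + s ∑ χ |ζ|²)`, if `s = ±1`. -/
def herm (s : ℝ) (χ : ι → ℝ) (ζ u v : ι → ℂ) : ℂ :=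
  pair χ u v / rad s χ ζ - s * pair χ u ζ * pair χ ζ v / rad s χ ζ ^ 2

theorem theta_add (s : ℝ) (χ : ι → ℝ) (ζ u v : ι → ℂ) :
    theta s χ ζ (u + v) = theta s χ ζ u + theta s χ ζ v := by
  simp only [theta, pair_add_left]; ring

theorem theta_smul (s : ℝ) (χ : ι → ℝ) (ζ : ι → ℂ) (c : ℂ) (v : ι → ℂ) :
    theta s χ ζ (c • v) = c * theta s χ ζ v := by
  simp only [theta, pair_smul_left]; ring

theorem conj_herm (s : ℝ) (χ : ι → ℝ) (ζ u v : ι → ℂ) :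
    conj (herm s χ ζ u v) = herm s χ ζ v u := by
  have : conj (rad s χ ζ) = rad s χ ζ := by rw [rad_eq, conj_ofReal]
  simp only [herm, map_sub, map_div₀, map_mul, map_pow, conj_pair, this, conj_ofReal]
  ring

theorem _root_.HasDerivAt.rad {s : ℝ} {χ : ι → ℝ} {ζ : ℝ → ι → ℂ} {ζ' : ι → ℂ} {t : ℝ}
    (h : HasDerivAt ζ ζ' t) : HasDerivAt (fun r => rad s χ (ζ r))
      (s * (pair χ ζ' (ζ t) + pair χ (ζ t) ζ')) t :=
  ((h.pair h).const_mul _).const_add 1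

/-- The quotient rule, arranged so that the antilinear part in `ζ'` is `s * herm`, the curvature
term of the tautological bundle. The condition `s * s = 1` makes `herm` appear with coefficient `s`.
-/
theorem hasDerivAt_theta {s : ℝ} (hs : s * s = 1) {χ : ι → ℝ} {ζ v : ℝ → ι → ℂ} {ζ' v' : ι → ℂ}
    {t : ℝ} (h0 : 0 < realRad s χ (ζ t)) (h : HasDerivAt ζ ζ' t) (hv : HasDerivAt v v' t) :
    HasDerivAt (fun r => theta s χ (ζ r) (v r))
      (theta s χ (ζ t) v' + s * herm s χ (ζ t) (v t) ζ' -
        theta s χ (ζ t) (v t) * theta s χ (ζ t) ζ') t := by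
  have hN := rad_ne_zero h0
  refine (((hv.pair h).const_mul (s : ℂ)).div h.rad hN).congr_deriv ?_
  have hs' : (s : ℂ) * s = 1 := by exact_mod_cast hs
  simp only [theta, herm]
  field_simp
  ring

/-- The derivative is displayed as a part complex linear in `ζ'` plus a part antilinear in `ζ'`, so
that `fderiv_wirtinger` can read off `∂h`. By Hermitian symmetry the second part is the conjugate of
the first with `u` and `v` exchanged. -/
theorem hasDerivAt_herm {s : ℝ} {χ : ι → ℝ} {ζ : ℝ → ι → ℂ} {ζ' : ι → ℂ}
    {t : ℝ} (h0 : 0 < realRad s χ (ζ t)) (h : HasDerivAt ζ ζ' t) (u v : ι → ℂ) :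
    HasDerivAt (fun r => herm s χ (ζ r) u v)
      (-(theta s χ (ζ t) ζ' * herm s χ (ζ t) u v + theta s χ (ζ t) u * herm s χ (ζ t) ζ' v) -
        conj (theta s χ (ζ t) ζ' * herm s χ (ζ t) v u + theta s χ (ζ t) v * herm s χ (ζ t) ζ' u))
      t := by
  have hN := rad_ne_zero h0
  have hu : HasDerivAt (fun _ : ℝ => u) 0 t := hasDerivAt_const t u
  have hv : HasDerivAt (fun _ : ℝ => v) 0 t := hasDerivAt_const t v
  have hr : conj (rad s χ (ζ t)) = rad s χ (ζ t) := by rw [rad_eq, conj_ofReal]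
  have z1 : ∀ w, pair χ 0 w = 0 := fun w => by simp [pair]
  have z2 : ∀ w, pair χ w 0 = 0 := fun w => by simp [pair]
  refine (((hasDerivAt_const t (pair χ u v)).div h.rad hN).sub
    (((((hu.pair h).const_mul (s : ℂ))).mul (h.pair hv)).div (h.rad.pow 2)
      (pow_ne_zero 2 hN))).congr_deriv ?_
  simp only [Pi.mul_apply, Pi.pow_apply, theta, map_add, map_mul, map_div₀, conj_herm, conj_pair, hr, conj_ofReal, z1, z2]
  simp only [herm]
  field_simp
  ring

end Pairing

/-! ### Derivatives along lines -/

theorem hasDerivAt_line {E : Type*} [NormedAddCommGroup E] [NormedSpace ℝ E] (x v : E) (t : ℝ) :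
    HasDerivAt (fun r : ℝ => x + r • v) v t := by
  simpa using ((hasDerivAt_id t).smul_const v).const_add x

/-- Differentiability is always supplied by a smoothness statement, so the value of a derivative may
be computed along straight lines only. -/
theorem fderiv_eq_of_hasDerivAt_line {E F : Type*} [NormedAddCommGroup E] [NormedSpace ℝ E]
    [NormedAddCommGroup F] [NormedSpace ℝ F] {f : E → F} {x v : E} {A : F}
    (hf : DifferentiableAt ℝ f x) (h : HasDerivAt (fun t : ℝ => f (x + t • v)) A 0) :
    fderiv ℝ f x v = A := by
  have h0 : HasFDerivAt f (fderiv ℝ f x) (x + (0 : ℝ) • v) := by simpa using hf.hasFDerivAt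
  exact (h0.comp_hasDerivAt 0 (hasDerivAt_line x v 0)).unique h

/-! ### Wirtinger derivatives from the splitting into linear and antilinear parts -/

section Wirtinger

variable {ι : Type*} [Fintype ι] [DecidableEq ι]

/-- The combination defining `∂_α` annihilates the antilinear part and reproduces the linear one,
and vice versa for `∂̄_α`. Only the behaviour of `A` and `B` under multiplication by `√-1` matters.
-/
theorem fderiv_wirtinger {f : (ι → ℂ) → ℂ} {ζ : ι → ℂ} (hf : DifferentiableAt ℝ f ζ)
    {A B : (ι → ℂ) → ℂ} (hA : ∀ v, A (I • v) = I * A v) (hB : ∀ v, B (I • v) = -(I * B v))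
    (h : ∀ v, HasDerivAt (fun t : ℝ => f (ζ + t • v)) (A v + B v) 0) (α : ι) :
    dz f α ζ = A (Pi.single α 1) ∧ dzBar f α ζ = B (Pi.single α 1) := by
  have e : (Pi.single α I : ι → ℂ) = I • Pi.single α 1 := by
    rw [← Pi.single_smul]; simp
  have h1 := fderiv_eq_of_hasDerivAt_line hf (h (Pi.single α 1))
  have h2 := fderiv_eq_of_hasDerivAt_line hf (h (I • Pi.single α 1))
  rw [hA, hB] at h2
  rw [dz, dzBar, e, h1, h2]
  constructor
  · linear_combination (-(A (Pi.single α 1)) + B (Pi.single α 1)) / 2 * I_mul_I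
  · linear_combination (A (Pi.single α 1) - B (Pi.single α 1)) / 2 * I_mul_I

end Wirtinger

theorem _root_.ContDiffAt.complex_div {E : Type*} [NormedAddCommGroup E] [NormedSpace ℝ E]
    {f g : E → ℂ} {x : E} {n : WithTop ℕ∞} (hf : ContDiffAt ℝ n f x) (hg : ContDiffAt ℝ n g x)
    (h : g x ≠ 0) : ContDiffAt ℝ n (fun y => f y / g y) x := by
  simp only [div_eq_mul_inv]
  exact hf.mul (hg.inv h)

/-! ### Smoothness of `1 + s ∑ χ |ζ|²` and of its logarithm -/

section Domain

variable {ι : Type*} [Fintype ι]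

theorem contDiffAt_rad (s : ℝ) (χ : ι → ℝ) (ζ : ι → ℂ) : ContDiffAt ℝ ∞ (rad s χ) ζ :=
  contDiffAt_const.add (contDiffAt_const.mul (contDiffAt_id.pair contDiffAt_id))

theorem realRad_eq_re (s : ℝ) (χ : ι → ℝ) (ζ : ι → ℂ) : realRad s χ ζ = (rad s χ ζ).re := by
  rw [rad_eq, ofReal_re]

theorem contDiffAt_realRad (s : ℝ) (χ : ι → ℝ) (ζ : ι → ℂ) : ContDiffAt ℝ ∞ (realRad s χ) ζ := by
  have : realRad s χ = fun ζ => reCLM (rad s χ ζ) := funext fun ζ => realRad_eq_re s χ ζ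
  rw [this]
  exact reCLM.contDiff.contDiffAt.comp ζ (contDiffAt_rad s χ ζ)

theorem eventually_realRad_pos {s : ℝ} {χ : ι → ℝ} {ζ : ι → ℂ} (h : 0 < realRad s χ ζ) :
    ∀ᶠ ξ in nhds ζ, 0 < realRad s χ ξ :=
  (contDiffAt_realRad s χ ζ).continuousAt.eventually (lt_mem_nhds h)

theorem hasDerivAt_log_realRad {s : ℝ} {χ : ι → ℝ} {ζ : ℝ → ι → ℂ} {ζ' : ι → ℂ} {t : ℝ}
    (h0 : 0 < realRad s χ (ζ t)) (h : HasDerivAt ζ ζ' t) :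
    HasDerivAt (fun r => (Real.log (realRad s χ (ζ r)) : ℂ))
      (s * (pair χ ζ' (ζ t) + pair χ (ζ t) ζ') / rad s χ (ζ t)) t := by
  have h1 : HasDerivAt (fun r => realRad s χ (ζ r))
      (reCLM (s * (pair χ ζ' (ζ t) + pair χ (ζ t) ζ'))) t := by
    simp only [realRad_eq_re]
    exact reCLM.hasFDerivAt.comp_hasDerivAt t h.rad
  refine (h1.log h0.ne').ofReal_comp.congr_deriv ?_
  -- The derivative of `rad` is invariant under conjugation, hence equal to its real part.
  have h2 : ((reCLM (s * (pair χ ζ' (ζ t) + pair χ (ζ t) ζ')) : ℝ) : ℂ) =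
      s * (pair χ ζ' (ζ t) + pair χ (ζ t) ζ') := by
    rw [reCLM_apply, ← conj_eq_iff_re]
    simp only [map_mul, map_add, conj_pair, conj_ofReal]
    ring
  rw [ofReal_div, h2, rad_eq]

end Domain

/-! ### The Kähler metric of `H^l × P^m` -/

/-- The indicator function of the coordinates of `H^l`. -/
def chiV : Fin l ⊕ Fin m → ℝ := Sum.elim (fun _ => 1) fun _ => 0

/-- The indicator function of the coordinates of `P^m`. -/
def chiW : Fin l ⊕ Fin m → ℝ := Sum.elim (fun _ => 0) fun _ => 1

theorem realRad_chiV (ζ : Fin l ⊕ Fin m → ℂ) :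
    realRad (-1) chiV ζ = 1 - ∑ i : Fin l, ‖ζ (Sum.inl i)‖ ^ 2 := by
  simp [realRad, chiV, sub_eq_add_neg]

theorem realRad_chiW (ζ : Fin l ⊕ Fin m → ℂ) :
    realRad 1 chiW ζ = 1 + ∑ i : Fin m, ‖ζ (Sum.inr i)‖ ^ 2 := by
  simp [realRad, chiW]

theorem realRad_chiW_pos (ζ : Fin l ⊕ Fin m → ℂ) : 0 < realRad 1 chiW ζ := by
  rw [realRad_chiW]; positivity

theorem kahlerPotential_eq (ζ : Fin l ⊕ Fin m → ℂ) : (kahlerPotential ζ : ℂ) =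
    -(Real.log (realRad (-1) chiV ζ) : ℂ) + (Real.log (realRad 1 chiW ζ) : ℂ) := by
  rw [realRad_chiV, realRad_chiW, kahlerPotential]
  push_cast
  rfl

theorem dzBar_kahlerPotential {ζ : Fin l ⊕ Fin m → ℂ} (hV : 0 < realRad (-1) chiV ζ)
    (β : Fin l ⊕ Fin m) : dzBar (fun ξ => (kahlerPotential ξ : ℂ)) β ζ =
      pair chiV ζ (Pi.single β 1) / rad (-1) chiV ζ +
        pair chiW ζ (Pi.single β 1) / rad 1 chiW ζ := by
  have hW := realRad_chiW_pos ζ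
  have hd : DifferentiableAt ℝ (fun ξ : Fin l ⊕ Fin m → ℂ => (kahlerPotential ξ : ℂ)) ζ := by
    simp only [kahlerPotential_eq]
    have h1 := ((contDiffAt_realRad (-1) chiV ζ).differentiableAt (by simp)).log hV.ne'
    have h2 := ((contDiffAt_realRad 1 chiW ζ).differentiableAt (by simp)).log hW.ne'
    exact (ofRealCLM.differentiableAt.comp ζ h1).neg.add (ofRealCLM.differentiableAt.comp ζ h2)
  refine (fderiv_wirtinger hd
    (A := fun v => pair chiV v ζ / rad (-1) chiV ζ + pair chiW v ζ / rad 1 chiW ζ)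
    (B := fun v => pair chiV ζ v / rad (-1) chiV ζ + pair chiW ζ v / rad 1 chiW ζ)
    (fun v => by simp only [pair_smul_left]; ring)
    (fun v => by simp only [pair_smul_right, conj_I]; ring) (fun v => ?_) β).2
  simp only [kahlerPotential_eq]
  have hl := hasDerivAt_line ζ v 0
  have e : ζ + (0 : ℝ) • v = ζ := by simp
  refine ((hasDerivAt_log_realRad (by rwa [e]) hl).neg.add
    (hasDerivAt_log_realRad (realRad_chiW_pos _) hl)).congr_deriv ?_
  rw [e]
  push_cast
  ring

/-- The metric as a sesquilinear form. -/
def hermM (ζ u v : Fin l ⊕ Fin m → ℂ) : ℂ := herm (-1) chiV ζ u v + herm 1 chiW ζ u v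

theorem dz_pair_div_rad {ι : Type*} [Fintype ι] [DecidableEq ι] {s : ℝ} {χ : ι → ℝ} {ζ : ι → ℂ}
    (h0 : 0 < realRad s χ ζ) (w v : ι → ℂ) :
    HasDerivAt (fun t : ℝ => pair χ (ζ + t • v) w / rad s χ (ζ + t • v))
      (herm s χ ζ v w + -(s * pair χ ζ w * pair χ ζ v / rad s χ ζ ^ 2)) 0 := by
  have hl := hasDerivAt_line ζ v 0
  have e : ζ + (0 : ℝ) • v = ζ := by simp
  have z : pair χ ζ 0 = 0 := by simp [pair]
  refine ((hl.pair (hasDerivAt_const (0 : ℝ) w)).div hl.rad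
    (by rw [e]; exact rad_ne_zero h0)).congr_deriv ?_
  have hN := rad_ne_zero h0
  rw [e, z, herm]
  field_simp
  ring

/-- The antiholomorphic derivative of the potential is `pair χ ζ (∂_β) / rad` on each factor; the
linear part of its differential is `herm`. -/
theorem metric_apply {ζ : Fin l ⊕ Fin m → ℂ} (hV : 0 < realRad (-1) chiV ζ)
    (α β : Fin l ⊕ Fin m) : metric ζ α β = hermM ζ (Pi.single α 1) (Pi.single β 1) := by
  have hW := realRad_chiW_pos ζ
  -- The closed form holds only on the chart domain. Since that set is open, this suffices to
  -- differentiate once more.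
  have he : dzBar (fun ξ => (kahlerPotential ξ : ℂ)) β =ᶠ[nhds ζ] fun ξ =>
      pair chiV ξ (Pi.single β 1) / rad (-1) chiV ξ +
        pair chiW ξ (Pi.single β 1) / rad 1 chiW ξ :=
    (eventually_realRad_pos hV).mono fun ξ hξ => dzBar_kahlerPotential hξ β
  have hc : ∀ (χ : Fin l ⊕ Fin m → ℝ) (s : ℝ), 0 < realRad s χ ζ → DifferentiableAt ℝ
      (fun ξ => pair χ ξ (Pi.single β 1) / rad s χ ξ) ζ := fun χ s h =>
    (((contDiffAt_id.pair contDiffAt_const).complex_div (contDiffAt_rad s χ ζ)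
      (rad_ne_zero h)).differentiableAt (n := ∞) (by simp))
  rw [metric, Matrix.of_apply, dz, he.fderiv_eq, ← dz]
  refine (fderiv_wirtinger ((hc _ _ hV).add (hc _ _ hW))
    (A := fun v => hermM ζ v (Pi.single β 1))
    (B := fun v => -(((-1 : ℝ) : ℂ) * pair chiV ζ (Pi.single β 1) * pair chiV ζ v /
        rad (-1) chiV ζ ^ 2) +
      -(((1 : ℝ) : ℂ) * pair chiW ζ (Pi.single β 1) * pair chiW ζ v / rad 1 chiW ζ ^ 2))
    (fun v => by simp only [hermM, herm, pair_smul_left]; ring)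
    (fun v => by simp only [pair_smul_right, conj_I]; ring) (fun v => ?_) α).1
  refine ((dz_pair_div_rad hV (Pi.single β 1) v).add
    (dz_pair_div_rad hW (Pi.single β 1) v)).congr_deriv ?_
  rw [hermM]
  ring

theorem contDiffAt_herm {ι : Type*} [Fintype ι] {s : ℝ} {χ : ι → ℝ} {ζ : ι → ℂ}
    (h0 : 0 < realRad s χ ζ) (u v : ι → ℂ) : ContDiffAt ℝ ∞ (fun ξ => herm s χ ξ u v) ζ := by
  have h := contDiffAt_rad s χ ζ
  exact (contDiffAt_const.complex_div h (rad_ne_zero h0)).sub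
    (((contDiffAt_const.mul (contDiffAt_const.pair contDiffAt_id)).mul
      (contDiffAt_id.pair contDiffAt_const)).complex_div (h.pow 2) (pow_ne_zero 2 (rad_ne_zero h0)))

theorem herm_smul_left {ι : Type*} [Fintype ι] (s : ℝ) (χ : ι → ℝ) (ζ : ι → ℂ) (c : ℂ)
    (u v : ι → ℂ) : herm s χ ζ (c • u) v = c * herm s χ ζ u v := by
  simp only [herm, pair_smul_left]; ring

/-- The linear part of `hasDerivAt_herm`. Its symmetry in `α` and `β` is the Kähler condition, and
each summand is again a multiple of the metric of one factor, which is what lets `christoffel_eq`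
avoid computing an inverse matrix. -/
theorem dz_metric {ζ : Fin l ⊕ Fin m → ℂ} (hV : 0 < realRad (-1) chiV ζ)
    (α β δ : Fin l ⊕ Fin m) : dz (fun ξ => metric ξ β δ) α ζ =
      -(theta (-1) chiV ζ (Pi.single α 1) * herm (-1) chiV ζ (Pi.single β 1) (Pi.single δ 1) +
        theta (-1) chiV ζ (Pi.single β 1) * herm (-1) chiV ζ (Pi.single α 1) (Pi.single δ 1)) -
      (theta 1 chiW ζ (Pi.single α 1) * herm 1 chiW ζ (Pi.single β 1) (Pi.single δ 1) +
        theta 1 chiW ζ (Pi.single β 1) * herm 1 chiW ζ (Pi.single α 1) (Pi.single δ 1)) := by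
  have hW := realRad_chiW_pos ζ
  have he : (fun ξ => metric ξ β δ) =ᶠ[nhds ζ] fun ξ =>
      herm (-1) chiV ξ (Pi.single β 1) (Pi.single δ 1) +
        herm 1 chiW ξ (Pi.single β 1) (Pi.single δ 1) :=
    (eventually_realRad_pos hV).mono fun ξ hξ => metric_apply hξ β δ
  rw [dz, he.fderiv_eq, ← dz]
  generalize (Pi.single β 1 : Fin l ⊕ Fin m → ℂ) = u
  generalize (Pi.single δ 1 : Fin l ⊕ Fin m → ℂ) = w
  refine (fderiv_wirtinger (((contDiffAt_herm hV u w).add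
    (contDiffAt_herm hW u w)).differentiableAt (by simp))
    (A := fun v =>
      -(theta (-1) chiV ζ v * herm (-1) chiV ζ u w + theta (-1) chiV ζ u * herm (-1) chiV ζ v w) -
      (theta 1 chiW ζ v * herm 1 chiW ζ u w + theta 1 chiW ζ u * herm 1 chiW ζ v w))
    -- Written as the conjugate of a complex linear expression, so that antilinearity is immediate.
    (B := fun v => conj (
      -(theta (-1) chiV ζ v * herm (-1) chiV ζ w u + theta (-1) chiV ζ w * herm (-1) chiV ζ v u) -
      (theta 1 chiW ζ v * herm 1 chiW ζ w u + theta 1 chiW ζ w * herm 1 chiW ζ v u)))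
    (fun v => by simp only [theta_smul, herm_smul_left]; ring)
    (fun v => by
      rw [← neg_mul, ← conj_I, ← map_mul]
      congr 1
      simp only [theta_smul, herm_smul_left]; ring) (fun v => ?_) α).1
  have hl := hasDerivAt_line ζ v 0
  have e : ζ + (0 : ℝ) • v = ζ := by simp
  refine ((hasDerivAt_herm (by rwa [e]) hl u w).add
    (hasDerivAt_herm (realRad_chiW_pos _) hl u w)).congr_deriv ?_
  rw [e]
  simp only [map_sub, map_neg]
  ring

/-! ### Positive definiteness of the metric -/

section HermSum

variable {ι : Type*} [Fintype ι]

theorem herm_add_left (s : ℝ) (χ : ι → ℝ) (ζ u u' v : ι → ℂ) :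
    herm s χ ζ (u + u') v = herm s χ ζ u v + herm s χ ζ u' v := by
  simp only [herm, pair_add_left]; ring

theorem herm_eq_sum_left [DecidableEq ι] (s : ℝ) (χ : ι → ℝ) (ζ u v : ι → ℂ) :
    herm s χ ζ u v = ∑ α, u α * herm s χ ζ (Pi.single α 1) v := by
  let f : (ι → ℂ) →ₗ[ℂ] ℂ :=
    { toFun := fun w => herm s χ ζ w v
      map_add' := fun w w' => herm_add_left s χ ζ w w' v
      map_smul' := fun c w => herm_smul_left s χ ζ c w v }
  conv_lhs => rw [← Finset.univ_sum_single u]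
  change f _ = ∑ α, u α * f _
  rw [map_sum]
  refine Finset.sum_congr rfl fun α _ => ?_
  rw [← smul_eq_mul, ← map_smul, ← Pi.single_smul, smul_eq_mul, mul_one]

theorem pair_single_left [DecidableEq ι] (χ : ι → ℝ) (α : ι) (v : ι → ℂ) :
    pair χ (Pi.single α 1) v = χ α * conj (v α) := by
  simp [pair, Pi.single_apply]

/-- The Cauchy–Schwarz inequality for the real vectors `√χ ‖u‖` and `√χ ‖v‖`. -/
theorem norm_pair_sq_le {χ : ι → ℝ} (hχ : ∀ α, 0 ≤ χ α) (u v : ι → ℂ) :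
    ‖pair χ u v‖ ^ 2 ≤ (∑ α, χ α * ‖u α‖ ^ 2) * ∑ α, χ α * ‖v α‖ ^ 2 := by
  have h1 : ‖pair χ u v‖ ≤ ∑ α, (√(χ α) * ‖u α‖) * (√(χ α) * ‖v α‖) := by
    refine (norm_sum_le _ _).trans (Finset.sum_le_sum fun α _ => le_of_eq ?_)
    have := Real.mul_self_sqrt (hχ α)
    rw [norm_mul, norm_mul, RCLike.norm_conj, norm_real, Real.norm_of_nonneg (hχ α)]
    linear_combination (-‖u α‖ * ‖v α‖) * this
  have h2 := Finset.sum_mul_sq_le_sq_mul_sq Finset.univ (fun α => √(χ α) * ‖u α‖)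
    fun α => √(χ α) * ‖v α‖
  simp only [mul_pow, Real.sq_sqrt (hχ _)] at h2
  exact (pow_le_pow_left₀ (norm_nonneg _) h1 2).trans h2

theorem herm_self (s : ℝ) (χ : ι → ℝ) (ζ v : ι → ℂ) : herm s χ ζ v v =
    (((∑ α, χ α * ‖v α‖ ^ 2) / realRad s χ ζ - s * ‖pair χ v ζ‖ ^ 2 / realRad s χ ζ ^ 2 : ℝ) : ℂ) := by
  have : pair χ v ζ * pair χ ζ v = ((‖pair χ v ζ‖ ^ 2 : ℝ) : ℂ) := by
    rw [← conj_pair χ v ζ, Complex.mul_conj']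
    push_cast
    rfl
  rw [herm, pair_self, rad_eq, mul_assoc, this]
  push_cast
  ring

/-- The form `herm` is positive definite on the support of `χ`. -/
theorem exists_herm_self {s : ℝ} (hs : s = 1 ∨ s = -1) {χ : ι → ℝ} (hχ : ∀ α, 0 ≤ χ α)
    {ζ : ι → ℂ} (h0 : 0 < realRad s χ ζ) (v : ι → ℂ) : ∃ r : ℝ, herm s χ ζ v v = r ∧ 0 ≤ r ∧
      (0 < ∑ α, χ α * ‖v α‖ ^ 2 → 0 < r) := by
  refine ⟨_, herm_self s χ ζ v, ?_⟩
  have hq := norm_pair_sq_le hχ v ζ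
  have hq0 : 0 ≤ ‖pair χ v ζ‖ ^ 2 := by positivity
  have hp : 0 ≤ ∑ α, χ α * ‖v α‖ ^ 2 :=
    Finset.sum_nonneg fun α _ => mul_nonneg (hχ α) (by positivity)
  have hN : realRad s χ ζ = 1 + s * ∑ α, χ α * ‖ζ α‖ ^ 2 := rfl
  generalize ∑ α, χ α * ‖v α‖ ^ 2 = p at *
  generalize ∑ α, χ α * ‖ζ α‖ ^ 2 = z at *
  generalize ‖pair χ v ζ‖ ^ 2 = q at *
  generalize realRad s χ ζ = N at *
  have e : p / N - s * q / N ^ 2 = (p * N - s * q) / N ^ 2 := by field_simp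
  rw [e]
  rcases hs with rfl | rfl
  -- Here `N = 1 + z`, so the numerator is `p + (p z - q)`, and `q ≤ p z` by Cauchy–Schwarz.
  · have h1 : p ≤ p * N - 1 * q := by rw [hN]; linarith
    exact ⟨div_nonneg (hp.trans h1) (by positivity),
      fun h => div_pos (h.trans_le h1) (by positivity)⟩
  -- In the hyperbolic case the correction `+ q` has the favourable sign, and only `N > 0` is
  -- needed.
  · have h1 : p * N ≤ p * N - -1 * q := by linarith
    exact ⟨div_nonneg ((mul_nonneg hp h0.le).trans h1) (by positivity),
      fun h => div_pos ((mul_pos h h0).trans_le h1) (by positivity)⟩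

end HermSum

theorem chiV_nonneg (α : Fin l ⊕ Fin m) : 0 ≤ chiV α := by cases α <;> simp [chiV]

theorem chiW_nonneg (α : Fin l ⊕ Fin m) : 0 ≤ chiW α := by cases α <;> simp [chiW]

/-- Each of the two forms is nonnegative and is positive as soon as `v` has a nonzero component in
its factor; a nonzero vector has one in at least one factor. -/
theorem hermM_self_pos {ζ : Fin l ⊕ Fin m → ℂ} (hV : 0 < realRad (-1) chiV ζ)
    {v : Fin l ⊕ Fin m → ℂ} (hv : v ≠ 0) : 0 < hermM ζ v v := by
  obtain ⟨r, hr, hr0, hr1⟩ := exists_herm_self (Or.inr rfl) chiV_nonneg hV v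
  obtain ⟨t, ht, ht0, ht1⟩ := exists_herm_self (Or.inl rfl) chiW_nonneg (realRad_chiW_pos ζ) v
  have hs : ∑ α, chiV α * ‖v α‖ ^ 2 + ∑ α, chiW α * ‖v α‖ ^ 2 = ∑ α, ‖v α‖ ^ 2 := by
    simp [chiV, chiW]
  have hp : 0 < ∑ α, ‖v α‖ ^ 2 := by
    obtain ⟨α, hα⟩ := Function.ne_iff.1 hv
    exact Finset.sum_pos' (fun _ _ => by positivity)
      ⟨α, Finset.mem_univ α, by have := norm_pos_iff.2 hα; positivity⟩
  rw [hermM, hr, ht, ← ofReal_add, Complex.zero_lt_real]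
  rcases (Finset.sum_nonneg fun α _ => mul_nonneg (chiV_nonneg α) (by positivity) :
    0 ≤ ∑ α, chiV α * ‖v α‖ ^ 2).lt_or_eq with h | h
  · exact add_pos_of_pos_of_nonneg (hr1 h) ht0
  · exact add_pos_of_nonneg_of_pos hr0 (ht1 (by linarith))

theorem conj_hermM (ζ u v : Fin l ⊕ Fin m → ℂ) : conj (hermM ζ u v) = hermM ζ v u := by
  simp only [hermM, map_add, conj_herm]

theorem hermM_eq_sum_left (ζ u v : Fin l ⊕ Fin m → ℂ) :
    hermM ζ u v = ∑ α, u α * hermM ζ (Pi.single α 1) v := by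
  simp only [hermM, mul_add, Finset.sum_add_distrib]
  rw [← herm_eq_sum_left, ← herm_eq_sum_left]

theorem metric_transpose_mulVec {ζ : Fin l ⊕ Fin m → ℂ} (hV : 0 < realRad (-1) chiV ζ)
    (u : Fin l ⊕ Fin m → ℂ) (β : Fin l ⊕ Fin m) :
    ((metric ζ)ᵀ *ᵥ u) β = hermM ζ u (Pi.single β 1) := by
  rw [hermM_eq_sum_left, Matrix.mulVec, dotProduct]
  exact Finset.sum_congr rfl fun α _ => by rw [Matrix.transpose_apply, metric_apply hV, mul_comm]

/-- The transpose occurs because the first index of `metric` belongs to the linear argument of the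
Hermitian form, while in `v^* G w` the linear argument stands on the right. -/
theorem star_dotProduct_metric {ζ : Fin l ⊕ Fin m → ℂ} (hV : 0 < realRad (-1) chiV ζ)
    (u v : Fin l ⊕ Fin m → ℂ) : star v ⬝ᵥ ((metric ζ)ᵀ *ᵥ u) = hermM ζ u v := by
  rw [← conj_hermM, hermM_eq_sum_left, map_sum, dotProduct]
  refine Finset.sum_congr rfl fun β _ => ?_
  rw [metric_transpose_mulVec hV, map_mul, conj_hermM]
  rfl

theorem metric_transpose_posDef {ζ : Fin l ⊕ Fin m → ℂ} (hV : 0 < realRad (-1) chiV ζ) :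
    (metric ζ)ᵀ.PosDef := by
  refine Matrix.PosDef.of_dotProduct_mulVec_pos ?_ fun x hx => ?_
  · refine Matrix.IsHermitian.ext fun α β => ?_
    rw [Matrix.transpose_apply, Matrix.transpose_apply, metric_apply hV, metric_apply hV]
    exact conj_hermM _ _ _
  · rw [star_dotProduct_metric hV]
    exact hermM_self_pos hV hx

/-! ### The connection -/

/-- The Christoffel symbols in closed form. -/
theorem christoffel_eq {ζ : Fin l ⊕ Fin m → ℂ} (hV : 0 < realRad (-1) chiV ζ)
    (γ α β : Fin l ⊕ Fin m) : christoffel ζ γ α β =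
      -(chiV γ * (theta (-1) chiV ζ (Pi.single α 1) * (Pi.single β 1 : _ → ℂ) γ +
        theta (-1) chiV ζ (Pi.single β 1) * (Pi.single α 1 : _ → ℂ) γ)) -
      chiW γ * (theta 1 chiW ζ (Pi.single α 1) * (Pi.single β 1 : _ → ℂ) γ +
        theta 1 chiW ζ (Pi.single β 1) * (Pi.single α 1 : _ → ℂ) γ) := by
  set g : Fin l ⊕ Fin m → ℂ := fun γ =>
      -(chiV γ * (theta (-1) chiV ζ (Pi.single α 1) * (Pi.single β 1 : _ → ℂ) γ +
        theta (-1) chiV ζ (Pi.single β 1) * (Pi.single α 1 : _ → ℂ) γ)) -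
      chiW γ * (theta 1 chiW ζ (Pi.single α 1) * (Pi.single β 1 : _ → ℂ) γ +
        theta 1 chiW ζ (Pi.single β 1) * (Pi.single α 1 : _ → ℂ) γ) with hg
  -- The metric is block diagonal, so multiplying a row by an indicator function extracts the block
  -- of one factor.
  have hVm : ∀ κ δ : Fin l ⊕ Fin m, chiV κ * metric ζ κ δ =
      herm (-1) chiV ζ (Pi.single κ 1) (Pi.single δ 1) := fun κ δ => by
    rw [metric_apply hV, hermM]
    cases κ <;> simp [herm, pair_single_left, chiV, chiW]
  have hWm : ∀ κ δ : Fin l ⊕ Fin m, chiW κ * metric ζ κ δ =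
      herm 1 chiW ζ (Pi.single κ 1) (Pi.single δ 1) := fun κ δ => by
    rw [metric_apply hV, hermM]
    cases κ <;> simp [herm, pair_single_left, chiV, chiW]
  -- The proposed symbols are verified with the index lowered, where `dz_metric` applies;
  -- invertibility of the metric then gives the claim.
  have h1 : (fun δ => dz (fun ξ => metric ξ β δ) α ζ) = g ᵥ* metric ζ := by
    funext δ
    rw [dz_metric hV, ← hVm, ← hVm, ← hWm, ← hWm, Matrix.vecMul, dotProduct]
    simp only [hg, Pi.single_apply, mul_ite, mul_one, mul_zero, sub_mul, neg_mul, add_mul, ite_mul,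
      zero_mul, mul_add, Finset.sum_sub_distrib, Finset.sum_neg_distrib, Finset.sum_add_distrib,
      Finset.sum_ite_eq', Finset.mem_univ, if_true]
    ring
  have hu : IsUnit (metric ζ).det := by
    rw [← Matrix.det_transpose]
    exact (Matrix.isUnit_iff_isUnit_det _).1 (metric_transpose_posDef hV).isUnit
  have h2 : christoffel ζ γ α β =
      ((fun δ => dz (fun ξ => metric ξ β δ) α ζ) ᵥ* (metric ζ)⁻¹) γ := rfl
  rw [h2, h1, Matrix.vecMul_vecMul, Matrix.mul_nonsing_inv _ hu, Matrix.vecMul_one]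

theorem theta_eq_sum {ι : Type*} [Fintype ι] [DecidableEq ι] (s : ℝ) (χ : ι → ℝ) (ζ v : ι → ℂ) :
    theta s χ ζ v = ∑ α, theta s χ ζ (Pi.single α 1) * v α := by
  simp only [theta, pair_single_left]
  rw [pair, Finset.mul_sum, Finset.sum_div]
  exact Finset.sum_congr rfl fun α _ => by ring

/-- The contraction of `christoffel_eq` with two vectors: on each factor `∇` differs from the
coordinate derivative by `-(θ(v) w + θ(w) v)`. -/
theorem connectionMatrix_mulVec {ζ : Fin l ⊕ Fin m → ℂ} (hV : 0 < realRad (-1) chiV ζ)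
    (v w : Fin l ⊕ Fin m → ℂ) (γ : Fin l ⊕ Fin m) : (connectionMatrix ζ v *ᵥ w) γ =
      -(chiV γ * (theta (-1) chiV ζ v * w γ + theta (-1) chiV ζ w * v γ)) -
        chiW γ * (theta 1 chiW ζ v * w γ + theta 1 chiW ζ w * v γ) := by
  simp only [Matrix.mulVec, dotProduct, connectionMatrix, Matrix.of_apply, christoffel_eq hV]
  have h1 : ∀ u x : Fin l ⊕ Fin m → ℂ, ∑ α, x α * (Pi.single α 1 : _ → ℂ) γ * u α = x γ * u γ :=
    fun u x => by simp [Pi.single_apply]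
  have h2 : ∀ β, ∑ α, (-(chiV γ * (theta (-1) chiV ζ (Pi.single α 1) * (Pi.single β 1 : _ → ℂ) γ +
        theta (-1) chiV ζ (Pi.single β 1) * (Pi.single α 1 : _ → ℂ) γ)) -
      chiW γ * (theta 1 chiW ζ (Pi.single α 1) * (Pi.single β 1 : _ → ℂ) γ +
        theta 1 chiW ζ (Pi.single β 1) * (Pi.single α 1 : _ → ℂ) γ)) * v α =
      -(chiV γ * (theta (-1) chiV ζ v * (Pi.single β 1 : _ → ℂ) γ +
        theta (-1) chiV ζ (Pi.single β 1) * v γ)) -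
      chiW γ * (theta 1 chiW ζ v * (Pi.single β 1 : _ → ℂ) γ +
        theta 1 chiW ζ (Pi.single β 1) * v γ) := fun β => by
    -- The component `v γ` is expanded over basis vectors too, so that both sides become sums over
    -- the same index and can be compared termwise.
    have e := h1 v fun _ => 1
    rw [theta_eq_sum (-1) chiV ζ v, theta_eq_sum 1 chiW ζ v, ← one_mul (v γ), ← e]
    simp only [Finset.mul_sum, Finset.sum_mul, ← Finset.sum_add_distrib, ← Finset.sum_neg_distrib,
      ← Finset.sum_sub_distrib]
    exact Finset.sum_congr rfl fun α _ => by ring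
  simp only [h2]
  have e := h1 w fun _ => 1
  rw [theta_eq_sum (-1) chiV ζ w, theta_eq_sum 1 chiW ζ w, ← one_mul (w γ), ← e]
  simp only [Finset.mul_sum, Finset.sum_mul, ← Finset.sum_add_distrib, ← Finset.sum_neg_distrib,
    ← Finset.sum_sub_distrib]
  exact Finset.sum_congr rfl fun α _ => by ring

/-! ### Orthogonal projection and the splitting of the tangent space -/

/-- The Gram matrix of linearly independent vectors for a positive definite form is positive
definite. This gives the inverse in `orthoProj` its intended meaning. -/
theorem isUnit_gram {ζ : Fin l ⊕ Fin m → ℂ} (hV : 0 < realRad (-1) chiV ζ)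
    (σ : Fin k ⊕ Fin (l + m - k) ≃ Fin l ⊕ Fin m) (S : Fin (l + m - k) → Fin k → ℂ) :
    IsUnit ((frame σ S)ᴴ * (metric ζ)ᵀ * frame σ S).det := by
  have h : Function.Injective (frame σ S).mulVec :=
    Matrix.mulVec_injective_iff.2 (frame_linearIndependent σ S)
  exact (Matrix.isUnit_iff_isUnit_det _).1
    ((metric_transpose_posDef hV).conjTranspose_mul_mul_same h).isUnit

theorem orthoProj_mul_frame {ζ : Fin l ⊕ Fin m → ℂ} (hV : 0 < realRad (-1) chiV ζ)
    (σ : Fin k ⊕ Fin (l + m - k) ≃ Fin l ⊕ Fin m) (S : Fin (l + m - k) → Fin k → ℂ) :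
    orthoProj ζ (frame σ S) * frame σ S = frame σ S := by
  have h := Matrix.nonsing_inv_mul _ (isUnit_gram hV σ S)
  simp only [orthoProj, Matrix.mul_assoc] at h ⊢
  rw [h, Matrix.mul_one]

theorem orthoProj_mul_self {ζ : Fin l ⊕ Fin m → ℂ} (hV : 0 < realRad (-1) chiV ζ)
    (σ : Fin k ⊕ Fin (l + m - k) ≃ Fin l ⊕ Fin m) (S : Fin (l + m - k) → Fin k → ℂ) :
    orthoProj ζ (frame σ S) * orthoProj ζ (frame σ S) = orthoProj ζ (frame σ S) := by
  have h := orthoProj_mul_frame hV σ S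
  -- Only the right factor is unfolded: it begins with the frame, which the left factor fixes.
  conv_lhs => enter [2]; rw [orthoProj]
  simp only [← Matrix.mul_assoc]
  rw [h, orthoProj]

/-- A vector and its projection have the same products with the frame, that is, the difference lies
in `K^⊥`. -/
theorem conjTranspose_frame_mul_orthoProj {ζ : Fin l ⊕ Fin m → ℂ} (hV : 0 < realRad (-1) chiV ζ)
    (σ : Fin k ⊕ Fin (l + m - k) ≃ Fin l ⊕ Fin m) (S : Fin (l + m - k) → Fin k → ℂ) :
    (frame σ S)ᴴ * (metric ζ)ᵀ * orthoProj ζ (frame σ S) = (frame σ S)ᴴ * (metric ζ)ᵀ := by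
  have h := Matrix.mul_nonsing_inv _ (isUnit_gram hV σ S)
  simp only [orthoProj, ← Matrix.mul_assoc] at h ⊢
  rw [h, Matrix.one_mul]

theorem conjTranspose_frame_mul_metric_mulVec {ζ : Fin l ⊕ Fin m → ℂ}
    (hV : 0 < realRad (-1) chiV ζ) (σ : Fin k ⊕ Fin (l + m - k) ≃ Fin l ⊕ Fin m)
    (S : Fin (l + m - k) → Fin k → ℂ) (v : Fin l ⊕ Fin m → ℂ) (i : Fin k) :
    (((frame σ S)ᴴ * (metric ζ)ᵀ) *ᵥ v) i = hermM ζ v ((frame σ S).col i) := by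
  rw [← Matrix.mulVec_mulVec, ← star_dotProduct_metric hV]
  rfl

/-- The orthogonal projection of a vector to the plane spanned by the frame, in terms of its
coordinates `σ (inl p)`. -/
theorem orthoProj_mulVec (ζ : Fin l ⊕ Fin m → ℂ) (σ : Fin k ⊕ Fin (l + m - k) ≃ Fin l ⊕ Fin m)
    (S : Fin (l + m - k) → Fin k → ℂ) (w : Fin l ⊕ Fin m → ℂ) :
    orthoProj ζ (frame σ S) *ᵥ w =
      ∑ p, (orthoProj ζ (frame σ S) *ᵥ w) (σ (Sum.inl p)) • (frame σ S).col p := by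
  -- The projection lies in the span of the columns. As the frame is the identity on the rows `σ
  -- (inl p)`, its coefficients there are its coordinates.
  have h : ∃ c : Fin k → ℂ, orthoProj ζ (frame σ S) *ᵥ w = frame σ S *ᵥ c := by
    simp only [orthoProj, Matrix.mul_assoc, ← Matrix.mulVec_mulVec]
    exact ⟨_, rfl⟩
  obtain ⟨c, hc⟩ := h
  have h2 : ∀ p, (frame σ S *ᵥ c) (σ (Sum.inl p)) = c p := fun p => by
    simp [frame, Matrix.mulVec, dotProduct]
  rw [hc]
  simp only [h2]
  exact (Matrix.mulVec_eq_sum _ _).trans (Finset.sum_congr rfl fun p _ => by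
    simp [Matrix.col])

/-- A vector is determined modulo the plane spanned by the frame by its components in the basis
`∂_{σ(r)}` of the quotient. -/
theorem eq_sum_frame_add (σ : Fin k ⊕ Fin (l + m - k) ≃ Fin l ⊕ Fin m)
    (S : Fin (l + m - k) → Fin k → ℂ) (w : Fin l ⊕ Fin m → ℂ) :
    w = frame σ S *ᵥ (fun p => w (σ (Sum.inl p))) +
      ∑ r, (w (σ (Sum.inr r)) - ∑ p, S r p * w (σ (Sum.inl p))) •
        (Pi.single (σ (Sum.inr r)) 1 : Fin l ⊕ Fin m → ℂ) := by
  funext α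
  obtain ⟨α, rfl⟩ := σ.surjective α
  rcases α with p | r
  · simp [frame, Matrix.mulVec, dotProduct]
  · simp [frame, Matrix.mulVec, dotProduct, Pi.single_apply]

/-- The component orthogonal to the plane `K` of the covariant derivative of a vector of the frame,
in terms of the vertical part of the tangent vector. -/
theorem covFrame_sub_orthoProj {ζ : Fin l ⊕ Fin m → ℂ} (hV : 0 < realRad (-1) chiV ζ)
    (σ : Fin k ⊕ Fin (l + m - k) ≃ Fin l ⊕ Fin m) (S : Fin (l + m - k) → Fin k → ℂ)
    (ζ' : Fin l ⊕ Fin m → ℂ) (S' : Fin (l + m - k) → Fin k → ℂ) (i : Fin k) :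
    (covFrame σ ζ S ζ' S').col i - orthoProj ζ (frame σ S) *ᵥ (covFrame σ ζ S ζ' S').col i =
      (1 - orthoProj ζ (frame σ S)) *ᵥ
        ∑ r, verticalPart σ ζ S ζ' S' r i •
          (Pi.single (σ (Sum.inr r)) 1 : Fin l ⊕ Fin m → ℂ) := by
  have h1 := eq_sum_frame_add σ S ((covFrame σ ζ S ζ' S').col i)
  have h2 : (1 - orthoProj ζ (frame σ S)) *ᵥ (frame σ S *ᵥ
      fun p => (covFrame σ ζ S ζ' S').col i (σ (Sum.inl p))) = 0 := by
    rw [Matrix.mulVec_mulVec, Matrix.sub_mul, Matrix.one_mul, orthoProj_mul_frame hV, sub_self,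
      Matrix.zero_mulVec]
  -- Projecting to `K^⊥` removes the part in the plane and leaves the class modulo `K`, which is the
  -- vertical part.
  have h3 := congrArg ((1 - orthoProj ζ (frame σ S)) *ᵥ ·) h1
  simp only [Matrix.mulVec_add, h2, zero_add] at h3
  rw [Matrix.sub_mulVec, Matrix.one_mulVec] at h3
  exact h3

/-- The frame is constant on the rows `σ (inl p)`, so the vertical part depends on `S'` only by
adding it. The subtracted term in `twistorJ` therefore cancels the contribution of the new base
velocity. -/
theorem verticalPart_twistorJ (σ : Fin k ⊕ Fin (l + m - k) ≃ Fin l ⊕ Fin m)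
    (ζ : Fin l ⊕ Fin m → ℂ) (S : Fin (l + m - k) → Fin k → ℂ) (ζ' : Fin l ⊕ Fin m → ℂ)
    (S' : Fin (l + m - k) → Fin k → ℂ) :
    verticalPart σ ζ S (twistorJ σ ζ S ζ' S').1 (twistorJ σ ζ S ζ' S').2 =
      I • verticalPart σ ζ S ζ' S' := by
  have h : ∀ (v : Fin l ⊕ Fin m → ℂ) (T : Fin (l + m - k) → Fin k → ℂ),
      verticalPart σ ζ S v T = T + verticalPart σ ζ S v 0 := by
    intro v T
    funext r i
    simp [verticalPart, covFrame, dframe]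
    ring
  rw [h]
  simp [twistorJ]

theorem sub_orthoProj_horizontalJ {ζ : Fin l ⊕ Fin m → ℂ} (hV : 0 < realRad (-1) chiV ζ)
    (σ : Fin k ⊕ Fin (l + m - k) ≃ Fin l ⊕ Fin m) (S : Fin (l + m - k) → Fin k → ℂ)
    (v : Fin l ⊕ Fin m → ℂ) :
    horizontalJ σ ζ S v - orthoProj ζ (frame σ S) *ᵥ horizontalJ σ ζ S v =
      I • (v - orthoProj ζ (frame σ S) *ᵥ v) := by
  have h := orthoProj_mul_self hV σ S
  simp only [horizontalJ, Matrix.mulVec_sub, Matrix.mulVec_smul, Matrix.mulVec_mulVec, h]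
  module

/-- Only the `K`-component of `v` pairs with `t_i`. There the structure is `-√-1`, and antilinearity
in the second slot turns this into `√-1`. -/
theorem hermM_horizontalJ {ζ : Fin l ⊕ Fin m → ℂ} (hV : 0 < realRad (-1) chiV ζ)
    (σ : Fin k ⊕ Fin (l + m - k) ≃ Fin l ⊕ Fin m) (S : Fin (l + m - k) → Fin k → ℂ)
    (v : Fin l ⊕ Fin m → ℂ) (i : Fin k) :
    hermM ζ ((frame σ S).col i) (horizontalJ σ ζ S v) = I * hermM ζ ((frame σ S).col i) v := by
  rw [← conj_hermM, ← conj_hermM ζ v, ← conjTranspose_frame_mul_metric_mulVec hV,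
    ← conjTranspose_frame_mul_metric_mulVec hV]
  have h := conjTranspose_frame_mul_orthoProj hV σ S
  simp only [horizontalJ, Matrix.mulVec_sub, Matrix.mulVec_smul, Matrix.mulVec_mulVec, h]
  simp

/-! ### Multilinear maps on finite-dimensional spaces -/

section Multilinear

variable {ι M : Type*} [Fintype ι] [NormedAddCommGroup M] [NormedSpace ℂ M] [FiniteDimensional ℂ M]

theorem continuous_alternatingMap (G : M [⋀^ι]→ₗ[ℂ] ℂ) : Continuous G := by
  classical
  let b := Module.finBasis ℂ M
  -- Expansion in a basis exhibits the map as a polynomial in the coordinates of its arguments.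
  have h : ∀ z : ι → M, G z = ∑ r : ι → Fin (Module.finrank ℂ M),
      (∏ i, b.coord (r i) (z i)) * G fun i => b (r i) := by
    intro z
    have hz : z = fun i => ∑ p, b.coord p (z i) • b p :=
      funext fun i => (b.sum_repr (z i)).symm
    conv_lhs => rw [hz]
    refine (G.toMultilinearMap.map_sum fun i p => b.coord p (z i) • b p).trans ?_
    exact Finset.sum_congr rfl fun r _ => G.toMultilinearMap.map_smul_univ _ _
  have hb : ∀ p, Continuous (b.coord p) := fun p => LinearMap.continuous_of_finiteDimensional _
  refine (continuous_congr h).2 (continuous_finsetSum _ fun r _ => (continuous_finsetProd _ fun i _ =>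
    (hb (r i)).comp (continuous_apply i)).mul continuous_const)

/-- An alternating map on a finite-dimensional complex space as a continuous real multilinear
map. -/
def realMultilinear (G : M [⋀^ι]→ₗ[ℂ] ℂ) [NormedSpace ℝ M] [IsScalarTower ℝ ℂ M] :
    ContinuousMultilinearMap ℝ (fun _ : ι => M) ℂ :=
  (⟨G.toMultilinearMap, continuous_alternatingMap G⟩ :
    ContinuousMultilinearMap ℂ (fun _ : ι => M) ℂ).restrictScalars ℝ

variable [NormedSpace ℝ M] [IsScalarTower ℝ ℂ M]

theorem contDiff_alternatingMap (G : M [⋀^ι]→ₗ[ℂ] ℂ) : ContDiff ℝ ∞ G :=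
  (realMultilinear G).contDiff

/-- The Leibniz rule: one argument at a time is replaced by its derivative. -/
theorem hasDerivAt_alternatingMap [DecidableEq ι] (G : M [⋀^ι]→ₗ[ℂ] ℂ) {z : ℝ → ι → M}
    {z' : ι → M} {t : ℝ} (h : HasDerivAt z z' t) : HasDerivAt (fun r => G (z r))
      (∑ i, G (Function.update (z t) i (z' i))) t := by
  have := ((realMultilinear G).hasFDerivAt (x := z t)).comp_hasDerivAt t h
  rw [ContinuousMultilinearMap.linearDeriv_apply] at this
  exact this

end Multilinear

/-! ### The map in a chart -/

theorem affine_eq {n : ℕ} (j : Fin (n + 1)) (y : Fin n → ℂ) :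
    affine j y = affine j 0 + daffine j y := by
  funext i
  rcases Fin.eq_self_or_eq_succAbove j i with rfl | ⟨i, rfl⟩ <;> simp [affine, daffine]

/-- The map `daffine` as a linear map. -/
def daffineLinear {n : ℕ} (j : Fin (n + 1)) : (Fin n → ℂ) →ₗ[ℂ] CVec n where
  toFun := daffine j
  map_add' u v := by
    funext i
    rcases Fin.eq_self_or_eq_succAbove j i with rfl | ⟨i, rfl⟩ <;> simp [daffine]
  map_smul' c v := by
    funext i
    rcases Fin.eq_self_or_eq_succAbove j i with rfl | ⟨i, rfl⟩ <;> simp [daffine]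

/-- Identifies the connection form of the tautological bundle with `∂ log (1 - |x|²)`, the same form
that governs the Christoffel symbols of this factor. -/
theorem tautForm_V (ζ v : Fin l ⊕ Fin m → ℂ) :
    tautForm (signV l) 0 (fun i => ζ (Sum.inl i)) (fun i => v (Sum.inl i)) =
      theta (-1) chiV ζ v := by
  rw [tautForm, bar_self_affine_V, ← realRad_chiV, theta, rad_eq]
  congr 1
  rw [bar_apply, Fin.sum_univ_succ]
  simp [signV, affine, daffine, pair, chiV, Fin.succ_ne_zero, mul_comm]

theorem bar_affine_self_W (j : Fin (m + 1)) (ζ : Fin l ⊕ Fin m → ℂ) :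
    bar (signW m) (affine j fun i => ζ (Sum.inr i)) (affine j fun i => ζ (Sum.inr i)) =
      rad 1 chiW ζ := by
  rw [bar_apply, Fin.sum_univ_succAbove _ j]
  simp [signW, affine, rad, pair, chiW, mul_comm]

theorem tautForm_W (j : Fin (m + 1)) (ζ v : Fin l ⊕ Fin m → ℂ) :
    tautForm (signW m) j (fun i => ζ (Sum.inr i)) (fun i => v (Sum.inr i)) =
      theta 1 chiW ζ v := by
  rw [tautForm, bar_affine_self_W, theta]
  congr 1
  rw [bar_apply, Fin.sum_univ_succAbove _ j]
  simp [signW, affine, daffine, pair, chiW, mul_comm]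

/-- The vector `(X, Y)`, where `X` and `Y` are the homogeneous coordinates of the point with affine
coordinates `ζ`. -/
def baseVec (j : Fin (m + 1)) (ζ : Fin l ⊕ Fin m → ℂ) : CVec l × CVec m :=
  (affine 0 fun i => ζ (Sum.inl i), affine j fun i => ζ (Sum.inr i))

/-- The vector of `p^⊥ ⊕ q^⊥` that corresponds to the tangent vector with components `w`. -/
def tangentVec (j : Fin (m + 1)) (ζ : Fin l ⊕ Fin m → ℂ) :
    (Fin l ⊕ Fin m → ℂ) →ₗ[ℂ] CVec l × CVec m where
  toFun w := (daffineLinear 0 (fun i => w (Sum.inl i)) - theta (-1) chiV ζ w • (baseVec j ζ).1,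
    daffineLinear j (fun i => w (Sum.inr i)) - theta 1 chiW ζ w • (baseVec j ζ).2)
  map_add' u v := by
    have h1 := map_add (daffineLinear (0 : Fin (l + 1))) (fun i => u (Sum.inl i))
      fun i => v (Sum.inl i)
    have h2 := map_add (daffineLinear j) (fun i => u (Sum.inr i)) fun i => v (Sum.inr i)
    refine Prod.ext ?_ ?_
    · simp only [theta_add, Prod.mk_add_mk]
      rw [sub_add_sub_comm, ← h1, add_smul]
      rfl
    · simp only [theta_add, Prod.mk_add_mk]
      rw [sub_add_sub_comm, ← h2, add_smul]
      rfl
  map_smul' c v := by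
    have h1 := map_smul (daffineLinear (0 : Fin (l + 1))) c fun i => v (Sum.inl i)
    have h2 := map_smul (daffineLinear j) c fun i => v (Sum.inr i)
    refine Prod.ext ?_ ?_
    · simp only [theta_smul, Prod.smul_mk, RingHom.id_apply, mul_smul, smul_sub, ← h1]
      rfl
    · simp only [theta_smul, Prod.smul_mk, RingHom.id_apply, mul_smul, smul_sub, ← h2]
      rfl

theorem orthoAlong_smul {n : ℕ} (ε : Fin (n + 1) → ℂ) {c : ℂ} (hc : c ≠ 0) (x : CVec n) :
    orthoAlong ε (c • x) = orthoAlong ε x := by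
  refine LinearMap.ext fun v => ?_
  have hc' : conj c ≠ 0 := by simpa using hc
  simp only [orthoAlong, LinearMap.sub_apply, LinearMap.smulRight_apply, bar_smul_self, map_smul,
    smul_smul, smul_eq_mul, mul_inv]
  congr 2
  field_simp

/-- Projection along a line does not depend on the vector spanning it, so the representative used in
the definition may be replaced by the affine one. -/
theorem orthoLift_mkQ {n : ℕ} (ε : Fin (n + 1) → ℂ) (p : ℙ ℂ (CVec n))
    (hp : bar ε p.rep p.rep ≠ 0) {x : CVec n} (hx : x ∈ p.submodule) (hx0 : x ≠ 0) (v : CVec n) :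
    orthoLift ε p hp (p.submodule.mkQ v) = orthoAlong ε x v := by
  obtain ⟨c, rfl⟩ := (mem_submodule_iff p (rep_mem p) p.rep_nonzero x).1 hx
  have hc : c ≠ 0 := by rintro rfl; simp at hx0
  rw [orthoAlong_smul ε hc]
  rfl

theorem orthoLift_coordTangentP {n : ℕ} (ε : Fin (n + 1) → ℂ) (j : Fin (n + 1)) (y v : Fin n → ℂ)
    (hp : bar ε (affinePoint j y).rep (affinePoint j y).rep ≠ 0) :
    orthoLift ε (affinePoint j y) hp (coordTangentP j (affinePoint j y) v ⟨_, affine_mem j y⟩) =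
      daffine j v - tautForm ε j y v • affine j y := by
  have h : affine j y j = 1 := by simp [affine]
  simp only [coordTangentP, LinearMap.smulRight_apply, LinearMap.comp_apply,
    Submodule.subtype_apply, LinearMap.proj_apply, h, one_smul]
  rw [orthoLift_mkQ ε _ hp (affine_mem j y) (affine_ne_zero j y)]
  simp only [orthoAlong, LinearMap.sub_apply, LinearMap.id_apply, LinearMap.smulRight_apply,
    smul_smul, tautForm, div_eq_mul_inv]

theorem tangentToVec_coordTangent (j : Fin (m + 1))
    (σ : Fin k ⊕ Fin (l + m - k) ≃ Fin l ⊕ Fin m) (u : chartDomain l m k)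
    (w : Fin l ⊕ Fin m → ℂ) :
    tangentToVec (chartPoint j σ u) ⟨_, affine_mem 0 _⟩ ⟨_, affine_mem j _⟩
      (coordTangent j (basePointV u.1.1) (basePointW j u.1.1) w) = tangentVec j u.1.1 w := by
  refine Prod.ext ?_ ?_
  · refine (orthoLift_coordTangentP (signV l) 0 (fun i => u.1.1 (Sum.inl i))
      (fun i => w (Sum.inl i)) _).trans ?_
    rw [tautForm_V]
    rfl
  · refine (orthoLift_coordTangentP (signW m) j (fun i => u.1.1 (Sum.inr i))
      (fun i => w (Sum.inr i)) _).trans ?_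
    rw [tautForm_W]
    rfl

/-- The alternating form `z_0, …, z_k ↦ λ((z_0 ∧ … ∧ z_k)_{a,b})`. -/
def bidegreeForm (k a b : ℕ)
    (lam : Module.Dual ℂ ((⋀[ℂ]^a (CVec l)) ⊗[ℂ] (⋀[ℂ]^b (CVec m)))) :
    (CVec l × CVec m) [⋀^Fin (k + 1)]→ₗ[ℂ] ℂ :=
  (lam ∘ₗ bidegreePart l m a b).compAlternatingMap (ExteriorAlgebra.ιMulti ℂ (k + 1))

/-- The vectors whose exterior product is the value of the map `φ_{a,b}` in a chart. -/
def pluckerFrame (j : Fin (m + 1)) (σ : Fin k ⊕ Fin (l + m - k) ≃ Fin l ⊕ Fin m)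
    (ζ : Fin l ⊕ Fin m → ℂ) (S : Fin (l + m - k) → Fin k → ℂ) : Fin (k + 1) → CVec l × CVec m :=
  Fin.cons (baseVec j ζ) fun i => tangentVec j ζ ((frame σ S).col i)

/-- By `wedgeFormula_extToVec` the two summands of the formula combine to `(x + y) ∧ ẑ`. In the
chart the value is thus `c` times a single alternating form evaluated on `X + Y` and the vectors of
the frame. -/
theorem plucker_chart (a b : ℕ) (lam : Module.Dual ℂ ((⋀[ℂ]^a (CVec l)) ⊗[ℂ] (⋀[ℂ]^b (CVec m))))
    (j : Fin (m + 1)) (σ : Fin k ⊕ Fin (l + m - k) ≃ Fin l ⊕ Fin m) (u : chartDomain l m k) :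
    lam (plucker l m k a b (chart a b j σ u)) =
      u.1.2.2 * bidegreeForm k a b lam (pluckerFrame j σ u.1.1 u.1.2.1) := by
  have h1 := plucker_tmul (a := a) (b := b) (chartPoint j σ u) ⟨_, affine_mem 0 _⟩
    ⟨_, affine_mem j _⟩ (exteriorPower.ιMulti ℂ k (planeFrame j σ u))
  have h2 : plucker l m k a b (chart a b j σ u) = u.1.2.2 •
      plucker l m k a b ⟨chartPoint j σ u, (exteriorPower.ιMulti ℂ k (planeFrame j σ u) ⊗ₜ[ℂ]
        (PiTensorProduct.tprod ℂ fun _ => ⟨_, affine_mem 0 _⟩)) ⊗ₜ[ℂ]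
        (PiTensorProduct.tprod ℂ fun _ => ⟨_, affine_mem j _⟩)⟩ :=
    map_smul (pluckerFiber a b (chartPoint j σ u)) _ _
  rw [h2, map_smul, h1, wedgeFormula_extToVec, extToVec_apply, smul_eq_mul]
  congr 1
  change lam (bidegreePart l m a b _) = lam (bidegreePart l m a b (ExteriorAlgebra.ιMulti ℂ _ _))
  congr 2
  rw [exteriorPower.ιMulti_apply_coe, ExteriorAlgebra.map_apply_ιMulti,
    ExteriorAlgebra.ιMulti_succ_apply, inV, inW, ← map_add]
  congr 1
  · congr 1
    simp [pluckerFrame, baseVec]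
  · congr 1
    funext i
    exact tangentToVec_coordTangent j σ u _

/-! ### Smoothness -/

theorem mem_chartDomain_iff (u : Coord l m k) :
    u ∈ chartDomain l m k ↔ 0 < realRad (-1) chiV u.1 := by
  rw [realRad_chiV, sub_pos]
  rfl

theorem isOpen_chartDomain : IsOpen (chartDomain l m k) := by
  rw [isOpen_iff_mem_nhds]
  intro u hu
  have h := eventually_realRad_pos ((mem_chartDomain_iff u).1 hu)
  exact (continuous_fst.continuousAt.eventually h).mono fun v hv => (mem_chartDomain_iff v).2 hv

theorem contDiff_daffineLinear {n : ℕ} (j : Fin (n + 1)) : ContDiff ℝ ∞ (daffineLinear (n := n) j) :=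
  (((daffineLinear j).restrictScalars ℝ).toContinuousLinearMap).contDiff

theorem baseVec_eq (j : Fin (m + 1)) (ζ : Fin l ⊕ Fin m → ℂ) : baseVec j ζ =
    (affine 0 0 + daffineLinear 0 fun i => ζ (Sum.inl i),
      affine j 0 + daffineLinear j fun i => ζ (Sum.inr i)) :=
  Prod.ext (affine_eq 0 fun i => ζ (Sum.inl i)) (affine_eq j fun i => ζ (Sum.inr i))

theorem contDiff_baseVec (j : Fin (m + 1)) : ContDiff ℝ ∞ (baseVec (l := l) j) := by
  have h1 : ContDiff ℝ ∞ fun ζ : Fin l ⊕ Fin m → ℂ => fun i : Fin l => ζ (Sum.inl i) := by fun_prop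
  have h2 : ContDiff ℝ ∞ fun ζ : Fin l ⊕ Fin m → ℂ => fun i : Fin m => ζ (Sum.inr i) := by fun_prop
  rw [show baseVec (l := l) j = _ from funext (baseVec_eq j)]
  exact (contDiff_const.add ((contDiff_daffineLinear 0).comp h1)).prodMk
    (contDiff_const.add ((contDiff_daffineLinear j).comp h2))

theorem contDiffAt_theta {ι E : Type*} [Fintype ι] [NormedAddCommGroup E] [NormedSpace ℝ E] {s : ℝ}
    {χ : ι → ℝ} {ζ w : E → ι → ℂ} {x : E} (h0 : 0 < realRad s χ (ζ x))
    (hζ : ContDiffAt ℝ ∞ ζ x) (hw : ContDiffAt ℝ ∞ w x) :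
    ContDiffAt ℝ ∞ (fun y => theta s χ (ζ y) (w y)) x :=
  (contDiffAt_const.mul (hw.pair hζ)).complex_div
    (contDiffAt_const.add (contDiffAt_const.mul (hζ.pair hζ))) (rad_ne_zero h0)

theorem contDiffAt_tangentVec {E : Type*} [NormedAddCommGroup E] [NormedSpace ℝ E]
    (j : Fin (m + 1)) {ζ w : E → Fin l ⊕ Fin m → ℂ} {x : E} (h0 : 0 < realRad (-1) chiV (ζ x))
    (hζ : ContDiffAt ℝ ∞ ζ x) (hw : ContDiffAt ℝ ∞ w x) :
    ContDiffAt ℝ ∞ (fun y => tangentVec j (ζ y) (w y)) x := by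
  have h1 : ContDiffAt ℝ ∞ (fun y => fun i : Fin l => w y (Sum.inl i)) x :=
    contDiffAt_pi.2 fun i => contDiffAt_pi.1 hw _
  have h2 : ContDiffAt ℝ ∞ (fun y => fun i : Fin m => w y (Sum.inr i)) x :=
    contDiffAt_pi.2 fun i => contDiffAt_pi.1 hw _
  have h3 := (contDiff_baseVec j).contDiffAt.comp x hζ
  exact (((contDiff_daffineLinear 0).contDiffAt.comp x h1).sub
    ((contDiffAt_theta h0 hζ hw).smul h3.fst)).prodMk
    (((contDiff_daffineLinear j).contDiffAt.comp x h2).sub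
      ((contDiffAt_theta (realRad_chiW_pos _) hζ hw).smul h3.snd))

theorem contDiff_frame_col (σ : Fin k ⊕ Fin (l + m - k) ≃ Fin l ⊕ Fin m) (i : Fin k) :
    ContDiff ℝ ∞ fun S : Fin (l + m - k) → Fin k → ℂ => (frame σ S).col i := by
  refine contDiff_pi.2 fun α => ?_
  obtain ⟨α, rfl⟩ := σ.surjective α
  rcases α with p | r
  · simpa [frame, Matrix.col] using contDiff_const
  · simp only [frame, Matrix.col, Matrix.of_apply, Matrix.transpose_apply, Equiv.symm_apply_apply,
      Sum.elim_inr]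
    fun_prop

theorem contDiffAt_pluckerFrame (j : Fin (m + 1)) (σ : Fin k ⊕ Fin (l + m - k) ≃ Fin l ⊕ Fin m)
    {u : Coord l m k} (hu : u ∈ chartDomain l m k) :
    ContDiffAt ℝ ∞ (fun v : Coord l m k => pluckerFrame j σ v.1 v.2.1) u := by
  refine contDiffAt_pi.2 fun i => ?_
  refine Fin.cases ?_ (fun i => ?_) i
  · exact (contDiff_baseVec j).contDiffAt.comp u contDiff_fst.contDiffAt
  · exact contDiffAt_tangentVec j ((mem_chartDomain_iff u).1 hu) contDiff_fst.contDiffAt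
      ((contDiff_frame_col σ i).contDiffAt.comp u contDiff_snd.fst.contDiffAt)

/-- The chart domain is open, so the extension by zero affects no derivative. -/
theorem inChart_plucker (a b : ℕ) (lam : Module.Dual ℂ ((⋀[ℂ]^a (CVec l)) ⊗[ℂ] (⋀[ℂ]^b (CVec m))))
    (j : Fin (m + 1)) (σ : Fin k ⊕ Fin (l + m - k) ≃ Fin l ⊕ Fin m) {u : Coord l m k}
    (hu : u ∈ chartDomain l m k) :
    inChart (fun e => lam (plucker l m k a b e)) j σ =ᶠ[nhds u] fun v =>
      v.2.2 * bidegreeForm k a b lam (pluckerFrame j σ v.1 v.2.1) := by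
  filter_upwards [isOpen_chartDomain.mem_nhds hu] with v hv
  rw [inChart, dif_pos hv, plucker_chart]

theorem contDiffAt_chart (a b : ℕ)
    (lam : Module.Dual ℂ ((⋀[ℂ]^a (CVec l)) ⊗[ℂ] (⋀[ℂ]^b (CVec m))))
    (j : Fin (m + 1)) (σ : Fin k ⊕ Fin (l + m - k) ≃ Fin l ⊕ Fin m) {u : Coord l m k}
    (hu : u ∈ chartDomain l m k) : ContDiffAt ℝ ∞ (fun v : Coord l m k =>
      v.2.2 * bidegreeForm k a b lam (pluckerFrame j σ v.1 v.2.1)) u :=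
  contDiff_snd.snd.contDiffAt.mul
    ((contDiff_alternatingMap _).contDiffAt.comp u (contDiffAt_pluckerFrame j σ hu))

/-! ### The derivative in a chart -/

/-- The coordinate derivative of `(X, Y)` is split into its part orthogonal to the lines and its
part along them; the latter is given by the tautological connection forms. -/
theorem hasDerivAt_baseVec (j : Fin (m + 1)) {ζ : ℝ → Fin l ⊕ Fin m → ℂ}
    {ζ' : Fin l ⊕ Fin m → ℂ} {t : ℝ} (h : HasDerivAt ζ ζ' t) :
    HasDerivAt (fun r => baseVec j (ζ r))
      (tangentVec j (ζ t) ζ' +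
        scale l m (theta (-1) chiV (ζ t) ζ') (theta 1 chiW (ζ t) ζ') (baseVec j (ζ t))) t := by
  have h1 : HasDerivAt (fun r => fun i : Fin l => ζ r (Sum.inl i)) (fun i => ζ' (Sum.inl i)) t :=
    hasDerivAt_pi.2 fun i => hasDerivAt_pi.1 h _
  have h2 : HasDerivAt (fun r => fun i : Fin m => ζ r (Sum.inr i)) (fun i => ζ' (Sum.inr i)) t :=
    hasDerivAt_pi.2 fun i => hasDerivAt_pi.1 h _
  have d1 := (((daffineLinear (0 : Fin (l + 1))).restrictScalars
    ℝ).toContinuousLinearMap).hasFDerivAt.comp_hasDerivAt t h1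
  have d2 := (((daffineLinear j).restrictScalars
    ℝ).toContinuousLinearMap).hasFDerivAt.comp_hasDerivAt t h2
  rw [show (fun r => baseVec j (ζ r)) = _ from funext fun r => baseVec_eq j (ζ r)]
  refine ((d1.const_add _).prodMk (d2.const_add _)).congr_deriv ?_
  refine Prod.ext ?_ ?_ <;> simp [tangentVec, scale]

/-- The image in `V ⊕ W` of the formula `connectionMatrix_mulVec`: the separate multiples on the two
factors become the operators `scale`. -/
theorem tangentVec_connection (j : Fin (m + 1)) {ζ : Fin l ⊕ Fin m → ℂ}
    (hV : 0 < realRad (-1) chiV ζ) (v w : Fin l ⊕ Fin m → ℂ) :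
    tangentVec j ζ (connectionMatrix ζ v *ᵥ w) =
      -(scale l m (theta (-1) chiV ζ v) (theta 1 chiW ζ v) (tangentVec j ζ w) +
        scale l m (theta (-1) chiV ζ w) (theta 1 chiW ζ w) (tangentVec j ζ v)) := by
  -- Each component of `tangentVec` sees only the coordinates of its own factor. There the
  -- connection term agrees with a global combination of `v` and `w`, to which linearity applies.
  have e1 : ∀ u u' : Fin l ⊕ Fin m → ℂ, (∀ i, u (Sum.inl i) = u' (Sum.inl i)) →
      (tangentVec j ζ u).1 = (tangentVec j ζ u').1 := fun u u' h => by
    simp [tangentVec, theta, pair, chiV, h]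
  have e2 : ∀ u u' : Fin l ⊕ Fin m → ℂ, (∀ i, u (Sum.inr i) = u' (Sum.inr i)) →
      (tangentVec j ζ u).2 = (tangentVec j ζ u').2 := fun u u' h => by
    simp [tangentVec, theta, pair, chiW, h]
  refine Prod.ext ?_ ?_
  · rw [e1 _ (-(theta (-1) chiV ζ v • w + theta (-1) chiV ζ w • v)) fun i => by
      simp [connectionMatrix_mulVec hV, chiV, chiW]]
    simp only [map_neg, map_add, map_smul]
    simp [scale]
  · rw [e2 _ (-(theta 1 chiW ζ v • w + theta 1 chiW ζ w • v)) fun i => by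
      simp [connectionMatrix_mulVec hV, chiV, chiW]]
    simp only [map_neg, map_add, map_smul]
    simp [scale]

/-- The components of the derivative of a tangent vector that are not tangent to `M`. -/
def secondForm (j : Fin (m + 1)) (ζ w v : Fin l ⊕ Fin m → ℂ) : CVec l × CVec m :=
  (herm (-1) chiV ζ w v • (baseVec j ζ).1, -(herm 1 chiW ζ w v • (baseVec j ζ).2))

/-- A Gauss formula: a tangential part, which is the covariant derivative, a second fundamental form
along the lines, and an infinitesimal scaling. The sign of `secondForm` differs on the two factors
because `θ` is differentiated with `s = -1` on one and `s = 1` on the other. -/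
theorem hasDerivAt_tangentVec (j : Fin (m + 1)) {ζ w : ℝ → Fin l ⊕ Fin m → ℂ}
    {ζ' w' : Fin l ⊕ Fin m → ℂ} {t : ℝ} (hV : 0 < realRad (-1) chiV (ζ t))
    (h : HasDerivAt ζ ζ' t) (hw : HasDerivAt w w' t) :
    HasDerivAt (fun r => tangentVec j (ζ r) (w r))
      (tangentVec j (ζ t) (w' + connectionMatrix (ζ t) ζ' *ᵥ w t) + secondForm j (ζ t) (w t) ζ' +
        scale l m (theta (-1) chiV (ζ t) ζ') (theta 1 chiW (ζ t) ζ') (tangentVec j (ζ t) (w t)))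
      t := by
  have h1 : HasDerivAt (fun r => fun i : Fin l => w r (Sum.inl i)) (fun i => w' (Sum.inl i)) t :=
    hasDerivAt_pi.2 fun i => hasDerivAt_pi.1 hw _
  have h2 : HasDerivAt (fun r => fun i : Fin m => w r (Sum.inr i)) (fun i => w' (Sum.inr i)) t :=
    hasDerivAt_pi.2 fun i => hasDerivAt_pi.1 hw _
  have d1 := (((daffineLinear (0 : Fin (l + 1))).restrictScalars
    ℝ).toContinuousLinearMap).hasFDerivAt.comp_hasDerivAt t h1
  have d2 := (((daffineLinear j).restrictScalars
    ℝ).toContinuousLinearMap).hasFDerivAt.comp_hasDerivAt t h2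
  have hb := hasDerivAt_baseVec j h
  have tV := hasDerivAt_theta (by norm_num) hV h hw
  have tW := hasDerivAt_theta (by norm_num) (realRad_chiW_pos (ζ t)) h hw
  refine ((d1.sub (tV.smul hb.fst)).prodMk (d2.sub (tW.smul hb.snd))).congr_deriv ?_
  rw [map_add, tangentVec_connection j hV]
  -- The vector attached to `ζ'` is kept opaque, since its multiples cancel as a whole.
  generalize hv : tangentVec j (ζ t) ζ' = v
  refine Prod.ext ?_ ?_
  · simp [tangentVec, scale, secondForm]
    module
  · simp [tangentVec, scale, secondForm]
    module

theorem hasDerivAt_frame_col (σ : Fin k ⊕ Fin (l + m - k) ≃ Fin l ⊕ Fin m)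
    (S S' : Fin (l + m - k) → Fin k → ℂ) (i : Fin k) :
    HasDerivAt (fun t : ℝ => (frame σ (S + t • S')).col i) ((dframe σ S').col i) 0 := by
  have : (fun t : ℝ => (frame σ (S + t • S')).col i) =
      fun t : ℝ => (frame σ S).col i + t • (dframe σ S').col i := by
    funext t α
    obtain ⟨α, rfl⟩ := σ.surjective α
    rcases α with p | r <;> simp [frame, dframe, Matrix.col]
  rw [this]
  exact hasDerivAt_line _ _ _

/-- The form `bidegreeForm` is homogeneous of degree `a` in the component in `V` and of degree `b`
in the component in `W`. -/
theorem bidegreeForm_scale (a b : ℕ)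
    (lam : Module.Dual ℂ ((⋀[ℂ]^a (CVec l)) ⊗[ℂ] (⋀[ℂ]^b (CVec m)))) (s t : ℂ)
    (z : Fin (k + 1) → CVec l × CVec m) :
    bidegreeForm k a b lam (fun i => scale l m s t (z i)) =
      s ^ a * t ^ b * bidegreeForm k a b lam z := by
  change lam (bidegreePart l m a b (ExteriorAlgebra.ιMulti ℂ _ _)) =
    s ^ a * t ^ b * lam (bidegreePart l m a b (ExteriorAlgebra.ιMulti ℂ _ _))
  rw [← smul_eq_mul, ← map_smul, ← bidegreePart_map_scale, ExteriorAlgebra.map_apply_ιMulti]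
  rfl

/-- The infinitesimal version of `bidegreeForm_scale`. -/
theorem sum_bidegreeForm_scale (a b : ℕ)
    (lam : Module.Dual ℂ ((⋀[ℂ]^a (CVec l)) ⊗[ℂ] (⋀[ℂ]^b (CVec m)))) (s t : ℂ)
    (z : Fin (k + 1) → CVec l × CVec m) :
    ∑ i, bidegreeForm k a b lam (Function.update z i (scale l m s t (z i))) =
      (a * s + b * t) * bidegreeForm k a b lam z := by
  have h1 := hasDerivAt_alternatingMap (bidegreeForm k a b lam)
    (hasDerivAt_line z (fun i => scale l m s t (z i)) 0)
  -- Moving each `z i` in the direction of its own scaling is the scaling by `1 + r s` and `1 + r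
  -- t`. Homogeneity makes this explicit in `r`, and comparing derivatives at `r = 0` gives the sum.
  have h2 : ∀ r : ℝ, bidegreeForm k a b lam (z + r • fun i => scale l m s t (z i)) =
      (1 + r * s) ^ a * (1 + r * t) ^ b * bidegreeForm k a b lam z := by
    intro r
    rw [← bidegreeForm_scale]
    congr 1
    funext i
    refine Prod.ext ?_ ?_ <;> funext α <;> simp [scale] <;> ring
  have h3 : ∀ c : ℂ, HasDerivAt (fun r : ℝ => 1 + (r : ℂ) * c) c 0 := fun c => by
    simpa using ((ofRealCLM.hasDerivAt (x := 0)).mul_const c).const_add 1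
  have h4 := (((h3 s).pow a).mul ((h3 t).pow b)).mul_const (bidegreeForm k a b lam z)
  simp only [h2] at h1
  have h5 := h1.unique h4
  simp only [zero_smul, add_zero] at h5
  rw [h5]
  simp

/-- The derivative of the vectors `pluckerFrame`, up to the infinitesimal scaling. -/
def pluckerFrameDeriv (j : Fin (m + 1)) (σ : Fin k ⊕ Fin (l + m - k) ≃ Fin l ⊕ Fin m)
    (ζ : Fin l ⊕ Fin m → ℂ) (S : Fin (l + m - k) → Fin k → ℂ) (ζ' : Fin l ⊕ Fin m → ℂ)
    (S' : Fin (l + m - k) → Fin k → ℂ) : Fin (k + 1) → CVec l × CVec m :=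
  Fin.cons (tangentVec j ζ ζ') fun i => tangentVec j ζ ((covFrame σ ζ S ζ' S').col i) +
    secondForm j ζ ((frame σ S).col i) ζ'

theorem hasDerivAt_pluckerFrame (j : Fin (m + 1))
    (σ : Fin k ⊕ Fin (l + m - k) ≃ Fin l ⊕ Fin m) {ζ : Fin l ⊕ Fin m → ℂ}
    (hV : 0 < realRad (-1) chiV ζ) (S : Fin (l + m - k) → Fin k → ℂ) (ζ' : Fin l ⊕ Fin m → ℂ)
    (S' : Fin (l + m - k) → Fin k → ℂ) :
    HasDerivAt (fun t : ℝ => pluckerFrame j σ (ζ + t • ζ') (S + t • S'))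
      (fun i => pluckerFrameDeriv j σ ζ S ζ' S' i +
        scale l m (theta (-1) chiV ζ ζ') (theta 1 chiW ζ ζ') (pluckerFrame j σ ζ S i)) 0 := by
  have e : ζ + (0 : ℝ) • ζ' = ζ := by simp
  have eS : S + (0 : ℝ) • S' = S := by simp
  have hl := hasDerivAt_line ζ ζ' 0
  refine hasDerivAt_pi.2 fun i => ?_
  refine Fin.cases ?_ (fun i => ?_) i
  · refine (hasDerivAt_baseVec j hl).congr_deriv ?_
    rw [e]
    rfl
  · refine (hasDerivAt_tangentVec j (by rwa [e]) hl (hasDerivAt_frame_col σ S S' i)).congr_deriv ?_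
    rw [e, eS]
    rfl

/-! ### The derivative modulo terms killed by a repeated vector -/

section Algebra

variable (G : (CVec l × CVec m) [⋀^Fin (k + 1)]→ₗ[ℂ] ℂ) (j : Fin (m + 1))
  (σ : Fin k ⊕ Fin (l + m - k) ≃ Fin l ⊕ Fin m) {ζ : Fin l ⊕ Fin m → ℂ}
  (S : Fin (l + m - k) → Fin k → ℂ)

theorem tangentVec_orthoProj (w : Fin l ⊕ Fin m → ℂ) :
    tangentVec j ζ (orthoProj ζ (frame σ S) *ᵥ w) =
      ∑ p, (orthoProj ζ (frame σ S) *ᵥ w) (σ (Sum.inl p)) • pluckerFrame j σ ζ S p.succ := by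
  conv_lhs => rw [orthoProj_mulVec]
  rw [map_sum]
  exact Finset.sum_congr rfl fun p _ => map_smul _ _ _

/-- The component of `w` in `K` is a combination of the vectors in the remaining slots, so it
contributes zero. -/
theorem update_tangentVec_zero (w : Fin l ⊕ Fin m → ℂ) :
    G (Function.update (pluckerFrame j σ ζ S) 0 (tangentVec j ζ w)) =
      G (Function.update (pluckerFrame j σ ζ S) 0
        (tangentVec j ζ (w - orthoProj ζ (frame σ S) *ᵥ w))) := by
  have h : G (Function.update (pluckerFrame j σ ζ S) 0
      (tangentVec j ζ (orthoProj ζ (frame σ S) *ᵥ w))) = 0 := by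
    rw [tangentVec_orthoProj, G.map_update_sum]
    refine Finset.sum_eq_zero fun p _ => ?_
    rw [G.map_update_smul, G.map_update_self _ (Fin.succ_ne_zero p).symm, smul_zero]
  rw [map_sub, G.map_update_sub, h, sub_zero]

/-- Of the component in `K`, only the coefficient of `t_i` survives, the other `t_p` being present
already. Summed over `i` these coefficients give the trace `grassForm`. -/
theorem update_tangentVec_succ (i : Fin k) (w : Fin l ⊕ Fin m → ℂ) :
    G (Function.update (pluckerFrame j σ ζ S) i.succ (tangentVec j ζ w)) =
      (orthoProj ζ (frame σ S) *ᵥ w) (σ (Sum.inl i)) * G (pluckerFrame j σ ζ S) +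
      G (Function.update (pluckerFrame j σ ζ S) i.succ
        (tangentVec j ζ (w - orthoProj ζ (frame σ S) *ᵥ w))) := by
  have h : G (Function.update (pluckerFrame j σ ζ S) i.succ
      (tangentVec j ζ (orthoProj ζ (frame σ S) *ᵥ w))) =
      (orthoProj ζ (frame σ S) *ᵥ w) (σ (Sum.inl i)) * G (pluckerFrame j σ ζ S) := by
    rw [tangentVec_orthoProj, G.map_update_sum, Finset.sum_eq_single i]
    · rw [G.map_update_smul, Function.update_eq_self, smul_eq_mul]
    · intro p _ hp
      rw [G.map_update_smul, G.map_update_self _ (fun h => hp (Fin.succ_injective _ h).symm),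
        smul_zero]
    · simp
  rw [map_sub, G.map_update_sub, h]
  ring

theorem update_secondForm (i : Fin k) (w v : Fin l ⊕ Fin m → ℂ) :
    G (Function.update (pluckerFrame j σ ζ S) i.succ (secondForm j ζ w v)) =
      hermM ζ w v * G (Function.update (pluckerFrame j σ ζ S) i.succ ((baseVec j ζ).1, 0)) := by
  -- Subtracting a multiple of `X + Y`, which occupies slot `0`, moves the normal term into `V`. The
  -- two block metrics then add up to the full metric.
  have h : secondForm j ζ w v = hermM ζ w v • ((baseVec j ζ).1, (0 : CVec m)) +
      (-herm 1 chiW ζ w v) • pluckerFrame j σ ζ S 0 := by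
    refine Prod.ext ?_ ?_
    · simp [secondForm, hermM, pluckerFrame]
      module
    · simp [secondForm, pluckerFrame]
  rw [h, G.map_update_add, G.map_update_smul, G.map_update_smul,
    G.map_update_self _ (Fin.succ_ne_zero i), smul_zero, add_zero, smul_eq_mul]

/-- The derivative of the map `φ_{a,b}` in a chart, expressed by the component `v` of the
tangent vector in `K^⊥`, the products `g` of its base component with the basis of `K`, and
its vertical component `A`. -/
def normalDeriv (ζ : Fin l ⊕ Fin m → ℂ) (v : Fin l ⊕ Fin m → ℂ) (g : Fin k → ℂ)
    (A : Fin (l + m - k) → Fin k → ℂ) : ℂ :=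
  G (Function.update (pluckerFrame j σ ζ S) 0 (tangentVec j ζ v)) +
    ∑ i, (G (Function.update (pluckerFrame j σ ζ S) i.succ (tangentVec j ζ
      ((1 - orthoProj ζ (frame σ S)) *ᵥ
        ∑ r, A r i • (Pi.single (σ (Sum.inr r)) 1 : Fin l ⊕ Fin m → ℂ)))) +
      g i * G (Function.update (pluckerFrame j σ ζ S) i.succ ((baseVec j ζ).1, 0)))

/-- Homogeneity under complex scalars, used for the scalar `√-1`: all the antilinearity in the base
velocity is hidden in the argument `g`. -/
theorem normalDeriv_smul (c : ℂ) (v : Fin l ⊕ Fin m → ℂ) (g : Fin k → ℂ)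
    (A : Fin (l + m - k) → Fin k → ℂ) : normalDeriv G j σ S ζ (c • v) (c • g) (c • A) =
      c * normalDeriv G j σ S ζ v g A := by
  have h : ∀ i, ∑ r, (c • A) r i • (Pi.single (σ (Sum.inr r)) 1 : Fin l ⊕ Fin m → ℂ) =
      c • ∑ r, A r i • (Pi.single (σ (Sum.inr r)) 1 : Fin l ⊕ Fin m → ℂ) := fun i => by
    rw [Finset.smul_sum]
    exact Finset.sum_congr rfl fun r _ => mul_smul c (A r i) _
  simp only [normalDeriv, h]
  simp only [Matrix.mulVec_smul, map_smul, G.map_update_smul, smul_eq_mul, mul_add,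
    Finset.mul_sum, Pi.smul_apply, mul_assoc]

/-- The part of the derivative without scaling: the trace over `K` gives the connection form of `Λ^k
K`, and what remains depends on the velocity only through the three quantities on which `J` acts as
`√-1`. -/
theorem sum_update_pluckerFrameDeriv (hV : 0 < realRad (-1) chiV ζ) (ζ' : Fin l ⊕ Fin m → ℂ)
    (S' : Fin (l + m - k) → Fin k → ℂ) :
    ∑ i, G (Function.update (pluckerFrame j σ ζ S) i (pluckerFrameDeriv j σ ζ S ζ' S' i)) =
      grassForm σ ζ S ζ' S' * G (pluckerFrame j σ ζ S) +
        normalDeriv G j σ S ζ (ζ' - orthoProj ζ (frame σ S) *ᵥ ζ')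
          (fun i => hermM ζ ((frame σ S).col i) ζ') (verticalPart σ ζ S ζ' S') := by
  have hg : grassForm σ ζ S ζ' S' =
      ∑ i, (orthoProj ζ (frame σ S) *ᵥ (covFrame σ ζ S ζ' S').col i) (σ (Sum.inl i)) := rfl
  rw [Fin.sum_univ_succ, normalDeriv, hg, Finset.sum_mul, ← add_assoc,
    add_comm (∑ i, _ * G (pluckerFrame j σ ζ S)), add_assoc, ← Finset.sum_add_distrib]
  congr 1
  · exact update_tangentVec_zero G j σ S ζ'
  · refine Finset.sum_congr rfl fun i _ => ?_
    rw [← covFrame_sub_orthoProj hV, ← update_secondForm, ← add_assoc, ← update_tangentVec_succ,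
      ← G.map_update_add]
    rfl

end Algebra

/-- The scaling terms, evaluated by `sum_bidegreeForm_scale`, contribute exactly the connection
forms of the powers `a` and `b` of the tautological bundles. The coefficient of the value is
therefore the vertical component `c' + c ω` for the canonical connection. -/
theorem fderiv_chart (a b : ℕ)
    (lam : Module.Dual ℂ ((⋀[ℂ]^a (CVec l)) ⊗[ℂ] (⋀[ℂ]^b (CVec m))))
    (j : Fin (m + 1)) (σ : Fin k ⊕ Fin (l + m - k) ≃ Fin l ⊕ Fin m) {u : Coord l m k}
    (hu : u ∈ chartDomain l m k) (v : Coord l m k) :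
    fderiv ℝ (fun w : Coord l m k =>
      w.2.2 * bidegreeForm k a b lam (pluckerFrame j σ w.1 w.2.1)) u v =
      (v.2.2 + u.2.2 * lineForm a b j σ u.1 u.2.1 v.1 v.2.1) *
        bidegreeForm k a b lam (pluckerFrame j σ u.1 u.2.1) +
      u.2.2 * normalDeriv (bidegreeForm k a b lam) j σ u.2.1 u.1
        (v.1 - orthoProj u.1 (frame σ u.2.1) *ᵥ v.1)
        (fun i => hermM u.1 ((frame σ u.2.1).col i) v.1)
        (verticalPart σ u.1 u.2.1 v.1 v.2.1) := by
  have hV := (mem_chartDomain_iff u).1 hu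
  refine fderiv_eq_of_hasDerivAt_line ((contDiffAt_chart a b lam j σ hu).differentiableAt
    (by simp)) ?_
  have h1 := hasDerivAt_alternatingMap (bidegreeForm k a b lam)
    (hasDerivAt_pluckerFrame j σ hV u.2.1 v.1 v.2.1)
  refine ((hasDerivAt_line u.2.2 v.2.2 0).mul h1).congr_deriv ?_
  simp only [zero_smul, add_zero, AlternatingMap.map_update_add, Finset.sum_add_distrib]
  rw [sum_bidegreeForm_scale, sum_update_pluckerFrameDeriv _ j σ u.2.1 hV, lineForm, tautForm_V,
    tautForm_W]
  ring

end BochnerTwistor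

end

/-! ### The Cauchy–Riemann equation -/

theorem mainTheorem1 (l m k a b : ℕ) (hk : k ≤ l + m) (hab : a + b = k + 1) :
    BochnerTwistor.IsHolomorphic (BochnerTwistor.plucker l m k a b) := by
  open BochnerTwistor in
  intro lam j σ u hu
  have hV := (mem_chartDomain_iff u).1 hu
  have he := inChart_plucker a b lam j σ hu
  refine ⟨(contDiffAt_chart a b lam j σ hu).congr_of_eventuallyEq he, fun v => ?_⟩
  rw [he.fderiv_eq, fderiv_chart a b lam j σ hu, fderiv_chart a b lam j σ hu]
  have h1 := sub_orthoProj_horizontalJ hV σ u.2.1 v.1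
  have h2 : (fun i => hermM u.1 ((frame σ u.2.1).col i) (totalJ a b j σ u v).1) =
      Complex.I • fun i => hermM u.1 ((frame σ u.2.1).col i) v.1 :=
    funext fun i => hermM_horizontalJ hV σ u.2.1 v.1 i
  have h3 := verticalPart_twistorJ σ u.1 u.2.1 v.1 v.2.1
  have h4 := normalDeriv_smul (bidegreeForm k a b lam) j σ (ζ := u.1) u.2.1 Complex.I
    (v.1 - (orthoProj u.1 (frame σ u.2.1)).mulVec v.1)
    (fun i => hermM u.1 ((frame σ u.2.1).col i) v.1) (verticalPart σ u.1 u.2.1 v.1 v.2.1)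
  -- The three arguments multiplied by `√-1` are replaced by those belonging to the image under `J`.
  rw [← h1, ← h2, ← h3] at h4
  refine (congrArg (fun x => _ + u.2.2 * x) h4).trans ?_
  -- What is left is the fibre direction, where `totalJ` is defined so that `c'' + c ω''` equals
  -- `√-1 (c' + c ω)`.
  simp only [totalJ]
  ring
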